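/- Let $\mathcal G=SO(2)_L\ltimes\mathbb R^3\times SO(2)_R$ be the group of triples $(\phi,a,\theta)$ with product $(\phi_1,a_1,\theta_1)(\phi_2,a_2,\theta_2)=(\phi_1+\phi_2,\ a_1+e^{\phi_1\hat e_3}a_2,\ \theta_1+\theta_2)$, where $e^{\phi\hat e_3}$ is the rotation by $\phi$ about the third axis. Let $\mathcal K=\mathbb R^3\times SO(2)_R=\{(0,a,\theta)\}$ and $SO(2)_D=\{(\phi,0,\phi)\}$; let $\mathfrak g=so(2)\oplus\mathbb R^3\oplus so(2)$ and $\mathfrak k=\mathbb R^3\oplus so(2)$ be the Lie algebras of $\mathcal G$ and $\mathcal K$. Let $(\mathcal M,\omega)$ be a connected (finite-dimensional, smooth, Hausdorff, second countable) symplectic manifold on which $\mathcal G$ acts smoothly, properly, faithfully and symplectically. Let $H:\mathcal M\to\mathbb R$ be smooth and $\mathcal G$-invariant, with Hamiltonian vector field $f_H$ given by $\omega(x)(f_H(x),w)=DH(x)w$. Let $J=(J^\phi,J^a,J^\theta):\mathcal M\to\mathfrak g^*$ be a smooth momentum map, $\omega(x)(\xi x,w)=DJ_\xi(x)w$, which is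 coadjoint equivariant, $J(gx)=(\mathrm{Ad}_g^*)^{-1}J(x)$. Put $J^{\mathcal K}=(J^a,J^\theta)$ and $J^{SO(2)_D}=J^\phi+J^\theta$. Let $x_e$ be an axisymmetric relative equilibrium of $\dot x=f_H(x)$: there is $\xi_e\in\mathfrak g$ such that $t\mapsto\exp(t\xi_e)x_e$ is a solution, and the isotropy group of $x_e$ is $\mathcal G_{x_e}=SO(2)_D$. Put $\nu_e=J^{\mathcal K}(x_e)$. By coordinates $w\in W=\mathbb R^d$ of the $\mathcal K$-reduced space near $x_e$ we mean a map $\sigma$, smooth near $0\in W$, with $\sigma(0)=x_e$, $J^{\mathcal K}(\sigma(w))=\nu_e$ for all $w$ near $0$, $D\sigma(0)$ injective and $\ker DJ^{\mathcal K}(x_e)=D\sigma(0)W\oplus\mathfrak k\,x_e$ (a slice for the $\mathcal K$-action on the level set $J^{\mathcal K}=\nu_e$). Write $H(\nu_e,w)=H(\sigma(w))$ and $J_W(w)=J^{SO(2)_D}(\sigma(w))$. The point $x_e$ is called formally stable if there is $\lambda\in\mathbb R$ such that, in all such coordinates, the Hessian $D_w^2\bigl(H(\nu_e,\cdot)+\lambda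 J_W\bigr)(0)$ on $W$ is positive or negative definite. **Proposition.** If $x_e$ is formally stable, then $x_e$ is $\mathcal K$-stable under perturbations that preserve the momentum $J^{\mathcal K}$: for every neighbourhood $U$ of $x_e$ there is a neighbourhood $V$ of $x_e$ such that every solution $x(t)$ of $\dot x=f_H(x)$ with $x(0)\in V$ and $J^{\mathcal K}(x(0))=\nu_e$ exists for all $t\in\mathbb R$ and stays in $\mathcal K U=\bigcup_{k\in\mathcal K}kU$. -/

import Mathlib

open scoped Manifold ContDiff Topology
open Set

noncomputable section

namespace AxiRelEq

/-! ### The group `𝒢 = SO(2) ⋉ ℝ³ × SO(2)` and its Lie algebra -/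

/-- Euclidean three-space. -/
abbrev E3 : Type := EuclideanSpace ℝ (Fin 3)

/-- The rotation `exp(φ ê₃)` of `ℝ³` about the third axis; the angle `φ ∈ SO(2)` is given by the
unit complex number `z = e^{iφ}`. -/
def rot (z : Circle) : E3 →L[ℝ] E3 :=
  LinearMap.toContinuousLinearMap
    { toFun := fun a => !₂[(z : ℂ).re * a 0 - (z : ℂ).im * a 1,
        (z : ℂ).im * a 0 + (z : ℂ).re * a 1, a 2]
      map_add' := fun a b => by ext i; fin_cases i <;> simp <;> ring
      map_smul' := fun c a => by ext i; fin_cases i <;> simp <;> ring }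

/-- The infinitesimal rotation `ê₃ a = e₃ × a`. -/
def hatE3 (a : E3) : E3 := !₂[-a 1, a 0, 0]

lemma rot_apply (z : Circle) (a : E3) :
    rot z a = !₂[(z : ℂ).re * a 0 - (z : ℂ).im * a 1,
      (z : ℂ).im * a 0 + (z : ℂ).re * a 1, a 2] := rfl

lemma rot_one (a : E3) : rot 1 a = a := by
  ext i; fin_cases i <;> simp [rot_apply]

lemma rot_mul (z w : Circle) (a : E3) : rot (z * w) a = rot z (rot w a) := by
  ext i; fin_cases i <;> simp [rot_apply] <;> ring

/-- Elements `g = (φ, a, θ)` of `𝒢`: `φ` in `SO(2)_L`, `a` in `ℝ³`, `θ` in `SO(2)_R`. -/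
@[ext] structure EucG where
  phi : Circle
  a : E3
  theta : Circle

namespace EucG

instance : Mul EucG := ⟨fun g h => ⟨g.phi * h.phi, g.a + rot g.phi h.a, g.theta * h.theta⟩⟩
instance : One EucG := ⟨⟨1, 0, 1⟩⟩
instance : Inv EucG := ⟨fun g => ⟨g.phi⁻¹, -rot g.phi⁻¹ g.a, g.theta⁻¹⟩⟩

@[simp] lemma mul_phi (g h : EucG) : (g * h).phi = g.phi * h.phi := rfl
@[simp] lemma mul_a (g h : EucG) : (g * h).a = g.a + rot g.phi h.a := rfl
@[simp] lemma mul_theta (g h : EucG) : (g * h).theta = g.theta * h.theta := rfl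
@[simp] lemma one_phi : (1 : EucG).phi = 1 := rfl
@[simp] lemma one_a : (1 : EucG).a = 0 := rfl
@[simp] lemma one_theta : (1 : EucG).theta = 1 := rfl
@[simp] lemma inv_phi (g : EucG) : (g⁻¹).phi = g.phi⁻¹ := rfl
@[simp] lemma inv_a (g : EucG) : (g⁻¹).a = -rot g.phi⁻¹ g.a := rfl
@[simp] lemma inv_theta (g : EucG) : (g⁻¹).theta = g.theta⁻¹ := rfl

instance : Group EucG :=
  Group.ofLeftAxioms
    (fun g h k => by ext1 <;> simp [mul_assoc, rot_mul, add_assoc])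
    (fun g => by ext1 <;> simp [rot_one])
    (fun g => by ext1 <;> simp)

/-- The topology of `𝒢`, that of `S¹ × ℝ³ × S¹`. -/
instance : TopologicalSpace EucG :=
  TopologicalSpace.induced (fun g => (g.phi, g.a, g.theta)) inferInstance

end EucG

/-- The subgroup `𝒦 = ℝ³ × SO(2)_R`. -/
def subgroupK : Subgroup EucG where
  carrier := {g | g.phi = 1}
  mul_mem' := fun {g h} hg hh => by
    change g.phi * h.phi = 1
    rw [show g.phi = 1 from hg, show h.phi = 1 from hh, one_mul]
  one_mem' := rfl
  inv_mem' := fun {g} hg => by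
    change g.phi⁻¹ = 1
    rw [show g.phi = 1 from hg, inv_one]

/-- The diagonal subgroup `SO(2)_D = {(φ, 0, φ)}`. -/
def subgroupD : Subgroup EucG where
  carrier := {g | g.a = 0 ∧ g.phi = g.theta}
  mul_mem' := fun {g h} hg hh => by
    refine ⟨?_, ?_⟩
    · rw [EucG.mul_a, hg.1, hh.1, map_zero, add_zero]
    · rw [EucG.mul_phi, EucG.mul_theta, hg.2, hh.2]
  one_mem' := ⟨rfl, rfl⟩
  inv_mem' := fun {g} hg => by
    refine ⟨?_, ?_⟩
    · rw [EucG.inv_a, hg.1, map_zero, neg_zero]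
    · rw [EucG.inv_phi, EucG.inv_theta, hg.2]

/-- The Lie algebra `𝔨 = ℝ³ ⊕ so(2)` of `𝒦`. -/
abbrev LieK : Type := E3 × ℝ

/-- The Lie algebra `𝔤 = so(2) ⊕ ℝ³ ⊕ so(2)` of `𝒢`, with elements `(ξ^φ, ξ^a, ξ^θ)`. -/
abbrev LieG : Type := ℝ × LieK

/-- The one-parameter subgroup `t ↦ exp(t ξ)` of `𝒢`. -/
def expG (ξ : LieG) (t : ℝ) : EucG where
  phi := Circle.exp (t * ξ.1)
  a := ∫ s in (0 : ℝ)..t, rot (Circle.exp (s * ξ.1)) ξ.2.1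
  theta := Circle.exp (t * ξ.2.2)

/-- The adjoint action `Ad_g ξ = g ξ g⁻¹` of `𝒢` on `𝔤`; see `conj_expG`. -/
def Ad (g : EucG) (ξ : LieG) : LieG :=
  (ξ.1, rot g.phi ξ.2.1 - ξ.1 • hatE3 g.a, ξ.2.2)

lemma continuous_rot_exp (c : ℝ) (a : E3) :
    Continuous fun s : ℝ => rot (Circle.exp (s * c)) a := by
  have h : Continuous fun s : ℝ => ((Circle.exp (s * c) : Circle) : ℂ) :=
    continuous_subtype_val.comp (Circle.exp.continuous.comp (by fun_prop))
  have hr := Complex.continuous_re.comp h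
  have hi := Complex.continuous_im.comp h
  simp only [rot_apply]
  refine (PiLp.continuous_toLp 2 _).comp (continuous_pi fun i => ?_)
  fin_cases i
  · exact (hr.mul continuous_const).sub (hi.mul continuous_const)
  · exact (hi.mul continuous_const).add (hr.mul continuous_const)
  · exact continuous_const

/-- `t ↦ exp(t ξ)` is a homomorphism. -/
lemma expG_add (ξ : LieG) (s t : ℝ) : expG ξ (s + t) = expG ξ s * expG ξ t := by
  have hc := continuous_rot_exp ξ.1 ξ.2.1
  ext1
  · simp [expG, add_mul, Circle.exp_add]
  · simp only [expG, EucG.mul_a]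
    rw [← ContinuousLinearMap.intervalIntegral_comp_comm _ (hc.intervalIntegrable _ _),
      ← intervalIntegral.integral_add_adjacent_intervals (b := s)
        (hc.intervalIntegrable _ _) (hc.intervalIntegrable _ _)]
    congr 1
    have := intervalIntegral.integral_comp_add_left
      (fun u => rot (Circle.exp (u * ξ.1)) ξ.2.1) s (a := 0) (b := t)
    rw [add_zero] at this
    rw [← this]
    refine intervalIntegral.integral_congr fun u _ => ?_
    simp only [← rot_mul, ← Circle.exp_add, add_mul]
  · simp [expG, add_mul, Circle.exp_add]

lemma rot_mul_comm (z w : Circle) (a : E3) : rot z (rot w a) = rot w (rot z a) := by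
  rw [← rot_mul, mul_comm, rot_mul]

lemma hasDerivAt_rot_exp (c : ℝ) (a : E3) (s : ℝ) :
    HasDerivAt (fun s : ℝ => rot (Circle.exp (s * c)) a)
      (rot (Circle.exp (s * c)) (c • hatE3 a)) s := by
  have hm : HasDerivAt (fun s : ℝ => s * c) c s := by simpa using (hasDerivAt_id s).mul_const c
  have hc := (Real.hasDerivAt_cos (s * c)).comp s hm
  have hs := (Real.hasDerivAt_sin (s * c)).comp s hm
  have h : HasDerivAt (fun s : ℝ => ![Real.cos (s * c) * a 0 - Real.sin (s * c) * a 1,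
      Real.sin (s * c) * a 0 + Real.cos (s * c) * a 1, a 2])
      ![-Real.sin (s * c) * c * a 0 - Real.cos (s * c) * c * a 1,
        Real.cos (s * c) * c * a 0 + -Real.sin (s * c) * c * a 1, 0] s := by
    rw [hasDerivAt_pi]
    intro i
    fin_cases i
    · exact (hc.mul_const (a 0)).sub (hs.mul_const (a 1))
    · exact (hs.mul_const (a 0)).add (hc.mul_const (a 1))
    · exact hasDerivAt_const s (a 2)
  have h2 := ((EuclideanSpace.equiv (Fin 3) ℝ).symm.hasFDerivAt).comp_hasDerivAt s h
  have e1 : (fun s : ℝ => rot (Circle.exp (s * c)) a) = ((EuclideanSpace.equiv (Fin 3) ℝ).symm ∘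
      fun s : ℝ => ![Real.cos (s * c) * a 0 - Real.sin (s * c) * a 1,
        Real.sin (s * c) * a 0 + Real.cos (s * c) * a 1, a 2]) := by
    funext u
    ext i
    fin_cases i <;> simp [rot_apply, Circle.coe_exp, Complex.exp_ofReal_mul_I_re,
      Complex.exp_ofReal_mul_I_im, -Complex.ofReal_mul]
  have e2 : rot (Circle.exp (s * c)) (c • hatE3 a) = (EuclideanSpace.equiv (Fin 3) ℝ).symm
      ![-Real.sin (s * c) * c * a 0 - Real.cos (s * c) * c * a 1,
        Real.cos (s * c) * c * a 0 + -Real.sin (s * c) * c * a 1, 0] := by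
    ext i
    fin_cases i <;> simp [rot_apply, hatE3, Circle.coe_exp, Complex.exp_ofReal_mul_I_re,
      Complex.exp_ofReal_mul_I_im, -Complex.ofReal_mul] <;> ring
  rw [e1, e2]
  exact h2

/-- `g exp(t ξ) g⁻¹ = exp(t Ad_g ξ)`. -/
lemma conj_expG (g : EucG) (ξ : LieG) (t : ℝ) : g * expG ξ t * g⁻¹ = expG (Ad g ξ) t := by
  ext1
  · simp [expG, Ad, mul_comm]
  · have hc := continuous_rot_exp ξ.1 ξ.2.1
    have hc1 := continuous_rot_exp ξ.1 (rot g.phi ξ.2.1)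
    have hc2 := continuous_rot_exp ξ.1 (ξ.1 • hatE3 g.a)
    have hF := intervalIntegral.integral_eq_sub_of_hasDerivAt
      (fun s _ => hasDerivAt_rot_exp ξ.1 g.a s) (hc2.intervalIntegrable 0 t)
    simp only [expG, Ad, EucG.mul_a, EucG.inv_a, EucG.mul_phi, map_sub, map_neg]
    rw [intervalIntegral.integral_sub (hc1.intervalIntegrable _ _) (hc2.intervalIntegrable _ _),
      hF, ← ContinuousLinearMap.intervalIntegral_comp_comm _ (hc.intervalIntegrable _ _),
      ← rot_mul, mul_right_comm, mul_inv_cancel, one_mul, zero_mul, Circle.exp_zero, rot_one]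
    simp only [rot_mul_comm g.phi]
    abel
  · simp [expG, Ad, mul_comm]

/-! ### Hamiltonian systems on a symplectic manifold `M` modelled on `E` -/

variable {E : Type*} [NormedAddCommGroup E] [NormedSpace ℝ E]
variable {M : Type*} [TopologicalSpace M] [ChartedSpace E M]

variable (E M) in
/-- A field of bilinear forms on the tangent spaces of `M`. -/
abbrev BilinField : Type _ :=
  ∀ x : M, TangentSpace 𝓘(ℝ, E) x →L[ℝ] TangentSpace 𝓘(ℝ, E) x →L[ℝ] ℝ

/-- The coordinate expression of `Ω` in the preferred chart at `x₀`, evaluated at the point of `E`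
with coordinates `y` on the coordinate vectors `u`, `v`. -/
def inChart (Ω : BilinField E M) (x₀ : M) (y u v : E) : ℝ :=
  Ω ((extChartAt 𝓘(ℝ, E) x₀).symm y)
    (mfderiv 𝓘(ℝ, E) 𝓘(ℝ, E) (extChartAt 𝓘(ℝ, E) x₀).symm y u)
    (mfderiv 𝓘(ℝ, E) 𝓘(ℝ, E) (extChartAt 𝓘(ℝ, E) x₀).symm y v)

/-- `Ω` is a symplectic form: a smooth, alternating, nondegenerate and closed two-form.
Closedness is `dΩ = 0`, written out in charts. -/
structure IsSymplecticForm [IsManifold 𝓘(ℝ, E) ∞ M] (Ω : BilinField E M) : Prop where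
  smooth : ContMDiff 𝓘(ℝ, E) (𝓘(ℝ, E).prod 𝓘(ℝ, E →L[ℝ] E →L[ℝ] ℝ)) ∞
    (fun x : M => Bundle.TotalSpace.mk' (E →L[ℝ] E →L[ℝ] ℝ)
      (E := fun x : M => TangentSpace 𝓘(ℝ, E) x →L[ℝ] TangentSpace 𝓘(ℝ, E) x →L[ℝ] ℝ) x (Ω x))
  alternating : ∀ (x : M) (u : TangentSpace 𝓘(ℝ, E) x), Ω x u u = 0
  nondegenerate : ∀ (x : M) (u : TangentSpace 𝓘(ℝ, E) x), (∀ v, Ω x u v = 0) → u = 0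
  closed : ∀ (x₀ : M), ∀ y ∈ (extChartAt 𝓘(ℝ, E) x₀).target, ∀ u v w : E,
    fderiv ℝ (fun z => inChart Ω x₀ z v w) y u + fderiv ℝ (fun z => inChart Ω x₀ z w u) y v
      + fderiv ℝ (fun z => inChart Ω x₀ z u v) y w = 0

open Classical in
/-- The Hamiltonian vector field `f_H`, determined by `Ω(x)(f_H(x), w) = DH(x) w`. -/
def hamVF (Ω : BilinField E M) (H : M → ℝ) (x : M) : TangentSpace 𝓘(ℝ, E) x :=
  if h : ∃ v : TangentSpace 𝓘(ℝ, E) x, ∀ w : TangentSpace 𝓘(ℝ, E) x,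
      Ω x v w = mfderiv 𝓘(ℝ, E) 𝓘(ℝ, ℝ) H x w
  then h.choose else 0

/-- In finite dimension `f_H` satisfies its defining equation. -/
lemma hamVF_spec [FiniteDimensional ℝ E] [IsManifold 𝓘(ℝ, E) ∞ M] {Ω : BilinField E M}
    (hΩ : IsSymplecticForm Ω) (H : M → ℝ) (x : M) (w : TangentSpace 𝓘(ℝ, E) x) :
    Ω x (hamVF Ω H x) w = mfderiv 𝓘(ℝ, E) 𝓘(ℝ, ℝ) H x w := by
  have h : ∃ v : TangentSpace 𝓘(ℝ, E) x, ∀ w : TangentSpace 𝓘(ℝ, E) x,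
      Ω x v w = mfderiv 𝓘(ℝ, E) 𝓘(ℝ, ℝ) H x w := by
    let L : E →ₗ[ℝ] Module.Dual ℝ E :=
      { toFun := fun v => ((Ω x v : TangentSpace 𝓘(ℝ, E) x →L[ℝ] ℝ) :
          TangentSpace 𝓘(ℝ, E) x →ₗ[ℝ] ℝ)
        map_add' := fun u v => by ext w; exact congrArg (fun f => f w) ((Ω x).map_add u v)
        map_smul' := fun c v => by ext w; exact congrArg (fun f => f w) ((Ω x).map_smul c v) }
    have hinj : Function.Injective L := by
      rw [injective_iff_map_eq_zero]
      intro u hu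
      exact hΩ.nondegenerate x u fun v => LinearMap.congr_fun hu v
    have hsurj : Function.Surjective L :=
      (LinearMap.injective_iff_surjective_of_finrank_eq_finrank
        (Subspace.dual_finrank_eq (K := ℝ) (V := E)).symm).1 hinj
    obtain ⟨v, hv⟩ := hsurj
      (ContinuousLinearMap.toLinearMap (M := E) (M₂ := ℝ) (mfderiv 𝓘(ℝ, E) 𝓘(ℝ, ℝ) H x))
    exact ⟨v, fun w => LinearMap.congr_fun hv w⟩
  rw [hamVF, dif_pos h]
  exact h.choose_spec w

/-! ### Symmetry and momentum -/

section Action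

variable [MulAction EucG M]

variable (E M) in
/-- The action map `𝒢 × M → M` is smooth. -/
def IsSmoothAction : Prop :=
  ContMDiff ((𝓡 1).prod (𝓘(ℝ, E3).prod ((𝓡 1).prod 𝓘(ℝ, E)))) 𝓘(ℝ, E) ∞
    (fun p : Circle × E3 × Circle × M => (⟨p.1, p.2.1, p.2.2.1⟩ : EucG) • p.2.2.2)

/-- `Ω` is `𝒢`-invariant. -/
def IsInvariantForm (Ω : BilinField E M) : Prop :=
  ∀ (g : EucG) (x : M) (u v : TangentSpace 𝓘(ℝ, E) x),
    Ω (g • x) (mfderiv 𝓘(ℝ, E) 𝓘(ℝ, E) (fun y : M => g • y) x u)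
      (mfderiv 𝓘(ℝ, E) 𝓘(ℝ, E) (fun y : M => g • y) x v) = Ω x u v

variable (E) in
/-- The infinitesimal action `ξ x = d/dt exp(t ξ) x` at `t = 0`. -/
def generator (ξ : LieG) (x : M) : TangentSpace 𝓘(ℝ, E) x :=
  mfderiv 𝓘(ℝ, ℝ) 𝓘(ℝ, E) (fun t : ℝ => expG ξ t • x) 0 (1 : ℝ)

/-- `J : M → 𝔤*` is a momentum map of the action, `Ω(x)(ξ x, w) = DJ_ξ(x) w` with
`J_ξ(x) = J(x)(ξ)`, that transforms by the coadjoint action, `J(g x) = (Ad_g^*)⁻¹ J(x)`. -/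
structure IsEquivariantMomentumMap (Ω : BilinField E M) (J : M → (LieG →L[ℝ] ℝ)) : Prop where
  smooth : ContMDiff 𝓘(ℝ, E) 𝓘(ℝ, LieG →L[ℝ] ℝ) ∞ J
  momentum : ∀ (ξ : LieG) (x : M) (w : TangentSpace 𝓘(ℝ, E) x),
    Ω x (generator E ξ x) w = mfderiv 𝓘(ℝ, E) 𝓘(ℝ, ℝ) (fun y => J y ξ) x w
  equivariant : ∀ (g : EucG) (x : M) (ξ : LieG), J (g • x) (Ad g ξ) = J x ξ

/-- The momentum map `J^𝒦 = (J^a, J^θ)` of `𝒦`, with values in `𝔨*`. -/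
def momentumK (J : M → (LieG →L[ℝ] ℝ)) (x : M) : LieK →L[ℝ] ℝ :=
  (J x).comp (ContinuousLinearMap.inr ℝ ℝ LieK)

/-- The momentum `J^φ + J^θ` of `SO(2)_D`. -/
def momentumD (J : M → (LieG →L[ℝ] ℝ)) (x : M) : ℝ := J x (1, 0, 1)

/-! ### Relative equilibria, formal stability, stability -/

/-- `x` is a relative equilibrium of `ẋ = X(x)`: for some `ξ ∈ 𝔤` the curve `exp(t ξ) x` is a
solution. -/
def IsRelativeEquilibrium (X : ∀ x : M, TangentSpace 𝓘(ℝ, E) x) (x : M) : Prop :=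
  ∃ ξ : LieG, IsMIntegralCurve (I := 𝓘(ℝ, E)) (fun t : ℝ => expG ξ t • x) X

variable (M) in
/-- `x` is axisymmetric: its isotropy subgroup is `SO(2)_D`. -/
def IsAxisymmetric (x : M) : Prop := MulAction.stabilizer EucG x = subgroupD

variable (E) in
/-- The derivative `Dσ(0) : ℝᵈ → T_x M` of a map `σ` with `σ(0) = x`. -/
def derivAtZero {d : ℕ} (x : M) (σ : EuclideanSpace ℝ (Fin d) → M) :
    EuclideanSpace ℝ (Fin d) →L[ℝ] TangentSpace 𝓘(ℝ, E) x :=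
  mfderiv 𝓘(ℝ, EuclideanSpace ℝ (Fin d)) 𝓘(ℝ, E) σ 0

variable (E) in
/-- `σ`, defined near `0` in `W = ℝᵈ`, parametrizes a realization near `x` of the reduced space
of `𝒦` at the momentum `ν_e = J^𝒦(x)`: the surface `σ(W)` lies in the level set
`J^𝒦 = ν_e`, passes through `x` at `w = 0`, and is there a slice for the action of `𝒦` on this
level set, i.e. `ker DJ^𝒦(x) = Dσ(0) W ⊕ 𝔨 x` with `Dσ(0)` injective. -/
structure IsReducedSlice (J : M → (LieG →L[ℝ] ℝ)) (x : M) {d : ℕ}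
    (σ : EuclideanSpace ℝ (Fin d) → M) : Prop where
  smooth : ContMDiffAt 𝓘(ℝ, EuclideanSpace ℝ (Fin d)) 𝓘(ℝ, E) ∞ σ 0
  base : σ 0 = x
  level : ∀ᶠ w in 𝓝 0, momentumK J (σ w) = momentumK J x
  spans : ∀ v : TangentSpace 𝓘(ℝ, E) x,
    mfderiv 𝓘(ℝ, E) 𝓘(ℝ, LieK →L[ℝ] ℝ) (momentumK J) x v = 0 ↔
      ∃ (w : EuclideanSpace ℝ (Fin d)) (κ : LieK), v = derivAtZero E x σ w + generator E (0, κ) x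
  transversal : ∀ (w : EuclideanSpace ℝ (Fin d)) (κ : LieK),
    derivAtZero E x σ w = generator E (0, κ) x → w = 0

/-- The second derivative of `F` at `0` is a (positive or negative) definite quadratic form. -/
def HasDefiniteHessian {d : ℕ} (F : EuclideanSpace ℝ (Fin d) → ℝ) : Prop :=
  (∀ w, w ≠ 0 → 0 < fderiv ℝ (fderiv ℝ F) 0 w w) ∨
    (∀ w, w ≠ 0 → fderiv ℝ (fderiv ℝ F) 0 w w < 0)

variable (E) in
/-- Formal stability of `x`: for some `λ ∈ ℝ` the Hessian `D²(H + λ J_W)(x)|_W` is definite, where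
`H(ν_e, w)` and `J_W(w)` are the Hamiltonian and `J^φ + J^θ` in any coordinates `w` of the reduced
space of `𝒦` near `x`. -/
def IsFormallyStable (H : M → ℝ) (J : M → (LieG →L[ℝ] ℝ)) (x : M) : Prop :=
  ∃ lam : ℝ, ∀ (d : ℕ) (σ : EuclideanSpace ℝ (Fin d) → M), IsReducedSlice E J x σ →
    HasDefiniteHessian (fun w => H (σ w) + lam * momentumD J (σ w))

/-- `A`-stability of `x` under perturbations within `P`: for every neighbourhood `U` of `x` there
is a neighbourhood `V` of `x` such that the solutions with initial data in `V ∩ P` exist for all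
(positive and negative) times and stay in `A U = ⋃_{g ∈ A} g U`. -/
def IsStableUnder (A : Set EucG) (X : ∀ x : M, TangentSpace 𝓘(ℝ, E) x) (P : Set M) (x : M) :
    Prop :=
  ∀ U ∈ 𝓝 x, ∃ V ∈ 𝓝 x, ∀ x₀ ∈ V ∩ P,
    (∃ γ : ℝ → M, γ 0 = x₀ ∧ IsMIntegralCurve (I := 𝓘(ℝ, E)) γ X) ∧
    ∀ (γ : ℝ → M) (a b : ℝ), a < 0 → 0 < b → γ 0 = x₀ →
      IsMIntegralCurveOn (I := 𝓘(ℝ, E)) γ X (Ioo a b) →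
      ∀ t ∈ Ioo a b, ∃ g ∈ A, ∃ u ∈ U, γ t = g • u

end Action

end AxiRelEq

end

open AxiRelEq

/-! The proof is the energy-momentum method. Let G = H + λ J^{SO(2)_D}, with λ from formal
stability. G is conserved: H because ω is alternating, the momentum by Noether's theorem
(`mfderiv_momentum_hamVF`). J^{SO(2)_D} need not be 𝒦-invariant on all of the manifold: translation
by a changes it by J^a(ê₃a). At an axisymmetric point J^a is parallel to the axis, so this
correction vanishes on the whole level set J^𝒦 = ν_e and G is 𝒦-invariant there (`momentumD_smul`).

The isotropy group SO(2)_D meets 𝒦 trivially, hence 𝒦 acts locally freely at x_e and J^𝒦 is a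
submersion there. This yields a slice σ whose 𝒦-translates cover a neighbourhood of x_e in the level
set (`exists_isReducedSlice`). Formal stability concerns all slices, and σ is the one to which it is
applied. On σ the point 0 is critical for H and for J^{SO(2)_D} (`IsReducedSlice.hasFDerivAt_zero`),
so a definite Hessian makes it a strict local minimum of G or of −G
(`eventually_lt_of_hessian_pos`).

Trapping (`exists_trapping`) is Lyapunov's argument modulo 𝒦: a curve at a level of G below its
minimum on a shell of the slice cannot cross the 𝒦-orbit of that shell. Properness enters by making
𝒦C closed for compact C. Solutions thus stay in 𝒦C, where translation invariance gives a uniform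
existence time (`exists_uniform_isMIntegralCurveOn`); they therefore exist for all time
(`exists_isMIntegralCurve_of_mapsTo`). The lemma `isStableUnder_of_strict_min` assembles these
pieces. -/

namespace AxiRelEq

/-! ### Linear algebra and calculus -/

/-- A complement of `range G` in `ker L`, parametrized by a Euclidean space. -/

lemma exists_euclidean_complement {E N X : Type*} [NormedAddCommGroup E] [NormedSpace ℝ E]
    [FiniteDimensional ℝ E] [NormedAddCommGroup N] [NormedSpace ℝ N] [NormedAddCommGroup X]
    [NormedSpace ℝ X] (L : E →L[ℝ] N) (G : X →L[ℝ] E) :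
    ∃ (d : ℕ) (ι : EuclideanSpace ℝ (Fin d) →L[ℝ] E), (∀ w, L (ι w) = 0) ∧
      (∀ v, L v = 0 → ∃ w κ, v = ι w + G κ) ∧ ∀ w κ, ι w = G κ → w = 0 := by
  let K : Submodule ℝ E := LinearMap.ker (L : E →ₗ[ℝ] N)
  -- Only the part of the range of G inside ker L is complemented, so the range need not lie in ker
  -- L.
  let S : Submodule ℝ K := (LinearMap.range (G : X →ₗ[ℝ] E)).comap K.subtype
  obtain ⟨C, hC⟩ := Submodule.exists_isCompl S
  let e : EuclideanSpace ℝ (Fin (Module.finrank ℝ C)) ≃L[ℝ] C :=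
    ContinuousLinearEquiv.ofFinrankEq (by simp)
  refine ⟨Module.finrank ℝ C, K.subtypeL ∘L C.subtypeL ∘L (e : _ →L[ℝ] C), ?_, ?_, ?_⟩
  · intro w
    exact (e w : K).2
  · intro v hv
    have htop : (⟨v, hv⟩ : K) ∈ S ⊔ C := by rw [hC.sup_eq_top]; trivial
    obtain ⟨s, ⟨κ, hκ⟩, c, hc, hsc⟩ := Submodule.mem_sup.1 htop
    refine ⟨e.symm ⟨c, hc⟩, κ, ?_⟩
    have h1 : (s : E) + c = v := congrArg Subtype.val hsc
    have h2 : G κ = s := hκ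
    simp [h2, ← h1, add_comm]
  · intro w κ hw
    have hS : (e w : K) ∈ S := ⟨κ, hw.symm⟩
    have h0 : (e w : K) = 0 := (Submodule.disjoint_def.1 hC.disjoint) _ hS (e w).2
    have : e w = 0 := Subtype.ext h0
    simpa using this

/-- Normal form of a submersion: in suitable coordinates it is its linear part. -/
lemma exists_straightening {E N : Type*} [NormedAddCommGroup E] [NormedSpace ℝ E]
    [CompleteSpace E] [NormedAddCommGroup N] [NormedSpace ℝ N]
    [FiniteDimensional ℝ N] {f : E → N} {y₀ : E} (hf : ContDiffAt ℝ ∞ f y₀)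
    (hsurj : Function.Surjective (fderiv ℝ f y₀)) :
    ∃ R : E → E, ContDiffAt ℝ ∞ R 0 ∧ R 0 = y₀ ∧ HasFDerivAt R (ContinuousLinearMap.id ℝ E) 0 ∧
      ∀ᶠ u in 𝓝 0, f (R u) = f y₀ + fderiv ℝ f y₀ u := by
  set L := fderiv ℝ f y₀ with hL
  obtain ⟨j₀, hj₀⟩ := (L : E →ₗ[ℝ] N).exists_rightInverse_of_surjective
    (LinearMap.range_eq_top.2 hsurj)
  let j : N →L[ℝ] E := LinearMap.toContinuousLinearMap j₀
  have hj : ∀ n, L (j n) = n := fun n => LinearMap.congr_fun hj₀ n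
  -- Since L ∘ j = id, the correction term gives L (Θ y) = f y − f y₀, while DΘ(y₀) = id because the
  -- correction vanishes to first order. R is the local inverse of Θ.
  let Θ : E → E := fun y => y - y₀ + j (f y - f y₀ - L (y - y₀))
  have hΘ : ContDiffAt ℝ ∞ Θ y₀ := by
    have h1 : ContDiffAt ℝ ∞ (fun y : E => y - y₀) y₀ := by fun_prop
    exact h1.add (j.contDiff.contDiffAt.comp y₀
      ((hf.sub contDiffAt_const).sub (L.contDiff.contDiffAt.comp y₀ h1)))
  have hΘ0 : Θ y₀ = 0 := by simp [Θ]
  have hfd : HasFDerivAt f L y₀ := (hf.differentiableAt (by simp)).hasFDerivAt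
  have hΘ' : HasFDerivAt Θ ((ContinuousLinearEquiv.refl ℝ E : E ≃L[ℝ] E) : E →L[ℝ] E) y₀ := by
    have h1 : HasFDerivAt (fun y : E => y - y₀) (ContinuousLinearMap.id ℝ E) y₀ :=
      (hasFDerivAt_id y₀).sub_const y₀
    have h2 := h1.add (j.hasFDerivAt.comp y₀ ((hfd.sub_const (f y₀)).sub
      (L.hasFDerivAt.comp y₀ h1)))
    refine h2.congr_fderiv ?_
    ext v
    simp
  have hn : (∞ : WithTop ℕ∞) ≠ 0 := by simp
  have hs := hΘ.hasStrictFDerivAt' hΘ' hn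
  refine ⟨hΘ.localInverse hΘ' hn, ?_, ?_, ?_, ?_⟩
  · have := hΘ.to_localInverse hΘ' hn
    rwa [hΘ0] at this
  · have := hΘ.localInverse_apply_image hΘ' hn
    rwa [hΘ0] at this
  · have := hs.to_localInverse.hasFDerivAt
    rw [hΘ0] at this
    exact this
  · have := hs.eventually_right_inverse
    rw [hΘ0] at this
    filter_upwards [this] with u hu
    have hu' : Θ (hΘ.localInverse hΘ' hn u) = u := hu
    have := congrArg L hu'
    simp only [Θ, map_add, hj] at this
    rw [← this]
    abel

/-- A nondegenerate minimum is strict. -/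
lemma eventually_lt_of_hessian_pos {W : Type*} [NormedAddCommGroup W] [NormedSpace ℝ W]
    [FiniteDimensional ℝ W] {h : W → ℝ} (hh : ContDiffAt ℝ 2 h 0) (h0 : fderiv ℝ h 0 = 0)
    (hpos : ∀ w, w ≠ 0 → 0 < fderiv ℝ (fderiv ℝ h) 0 w w) :
    ∀ᶠ w in 𝓝 0, w ≠ 0 → h 0 < h w := by
  set B := fderiv ℝ (fderiv ℝ h) 0 with hB
  -- c is the minimum of B on the unit sphere; homogeneity extends the bound to all w.
  obtain ⟨c, hc, hcB⟩ : ∃ c > 0, ∀ w, c * ‖w‖ ^ 2 ≤ B w w := by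
    rcases subsingleton_or_nontrivial W with hW | hW
    · exact ⟨1, one_pos, fun w => by rw [Subsingleton.elim w 0]; simp⟩
    have hcont : Continuous fun w : W => B w w := by fun_prop
    obtain ⟨u, hu, hmin⟩ := (isCompact_sphere (0 : W) 1).exists_isMinOn
      (NormedSpace.sphere_nonempty.2 zero_le_one) hcont.continuousOn
    have hu1 : ‖u‖ = 1 := by simpa using hu
    refine ⟨B u u, hpos u (by rintro rfl; simp at hu1), fun w => ?_⟩
    rcases eq_or_ne w 0 with rfl | hw
    · simp
    have hw' : ‖w‖ ≠ 0 := norm_ne_zero_iff.2 hw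
    have hm : B u u ≤ B (‖w‖⁻¹ • w) (‖w‖⁻¹ • w) := hmin (by simp [norm_smul, hw'])
    simp only [map_smul, smul_apply, smul_eq_mul] at hm
    calc B u u * ‖w‖ ^ 2 ≤ (‖w‖⁻¹ * (‖w‖⁻¹ * B w w)) * ‖w‖ ^ 2 := by gcongr
      _ = B w w := by field_simp
  have hd1 : ContDiffAt ℝ 1 (fderiv ℝ h) 0 := hh.fderiv_right (by norm_num)
  have hder : HasFDerivAt (fderiv ℝ h) B 0 := (hd1.differentiableAt (by simp)).hasFDerivAt
  have hlo := hder.isLittleO.def (half_pos hc)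
  have hdiff : ∀ᶠ y in 𝓝 (0 : W), DifferentiableAt ℝ h y :=
    (hh.eventually (by simp)).mono fun y hy => hy.differentiableAt (by simp)
  obtain ⟨δ, hδ, hball⟩ := Metric.eventually_nhds_iff_ball.1 (hlo.and hdiff)
  filter_upwards [Metric.ball_mem_nhds (0 : W) hδ] with w hw hw0
  have hwδ : ‖w‖ < δ := by simpa using hw
  have hmem : ∀ t ∈ Icc (0 : ℝ) 1, t • w ∈ Metric.ball (0 : W) δ := fun t ht => by
    simp only [Metric.mem_ball, dist_zero_right, norm_smul, Real.norm_eq_abs, abs_of_nonneg ht.1]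
    nlinarith [ht.2, norm_nonneg w]
  have hφ : ∀ t ∈ Icc (0 : ℝ) 1, HasDerivAt (fun t : ℝ => h (t • w)) (fderiv ℝ h (t • w) w) t := by
    intro t ht
    have h1 : HasDerivAt (fun t : ℝ => t • w) w t := by
      simpa using (hasDerivAt_id t).smul_const w
    exact (hball _ (hmem t ht)).2.hasFDerivAt.comp_hasDerivAt t h1
  -- Along the ray to w the derivative is at least t·B(w,w) − (c/2)t‖w‖² ≥ (c/2)t‖w‖², so
  -- differentiability of the gradient at 0 replaces Taylor's formula.
  have hmono : StrictMonoOn (fun t : ℝ => h (t • w)) (Icc 0 1) := by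
    refine strictMonoOn_of_deriv_pos (convex_Icc 0 1)
      (fun t ht => (hφ t ht).continuousAt.continuousWithinAt) fun t ht => ?_
    rw [interior_Icc] at ht
    have ht' : t ∈ Icc (0 : ℝ) 1 := Ioo_subset_Icc_self ht
    rw [(hφ t ht').deriv]
    have h1 := (hball _ (hmem t ht')).1
    rw [h0, sub_zero, sub_zero, norm_smul, Real.norm_eq_abs, abs_of_pos ht.1] at h1
    have h2 : |(fderiv ℝ h (t • w) - B (t • w)) w| ≤ c / 2 * (t * ‖w‖) * ‖w‖ :=
      ((fderiv ℝ h (t • w) - B (t • w)).le_opNorm w).trans (by gcongr)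
    have h3 := (abs_le.1 h2).1
    have h4 := hcB w
    simp only [sub_apply, map_smul, smul_apply,
      smul_eq_mul] at h3
    have h5 : 0 < ‖w‖ ^ 2 := by positivity
    nlinarith [mul_le_mul_of_nonneg_left h4 ht.1.le, mul_pos (mul_pos hc ht.1) h5]
  simpa using hmono (by simp) (by simp) zero_lt_one

/-! ### Integral curves -/

section IntegralCurves

variable {E : Type*} [NormedAddCommGroup E] [NormedSpace ℝ E]
  {M : Type*} [TopologicalSpace M] [ChartedSpace E M] [IsManifold 𝓘(ℝ, E) 1 M]
  {v : (x : M) → TangentSpace 𝓘(ℝ, E) x}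

/-- Integral curves of a `C¹` vector field exist for a locally uniform time. -/
lemma exists_eventually_isMIntegralCurveOn [CompleteSpace E] {x₀ : M}
    (hv : ContMDiffAt 𝓘(ℝ, E) 𝓘(ℝ, E).tangent 1
      (fun x => (⟨x, v x⟩ : TangentBundle 𝓘(ℝ, E) M)) x₀) :
    ∃ ε > 0, ∀ᶠ x in 𝓝 x₀, ∃ γ : ℝ → M, γ 0 = x ∧
      IsMIntegralCurveOn (I := 𝓘(ℝ, E)) γ v (Ioo (-ε) ε) := by
  rw [contMDiffAt_iff] at hv
  obtain ⟨_, hv⟩ := hv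
  obtain ⟨ε, hε, a, r, _, _, hr, hpl⟩ := IsPicardLindelof.of_contDiffAt_one
    (hv.contDiffAt (range_mem_nhds_isInteriorPoint BoundarylessManifold.isInteriorPoint)).snd
  obtain ⟨α, hα, hcont⟩ :=
    (hpl 0).exists_forall_mem_closedBall_eq_hasDerivWithinAt_continuousOn
  have hopen : IsOpen (extChartAt 𝓘(ℝ, E) x₀).target := isOpen_extChartAt_target x₀
  set y₀ := extChartAt 𝓘(ℝ, E) x₀ x₀ with hy₀
  simp only [zero_sub, zero_add] at hα hcont
  have hball : Metric.closedBall y₀ (r : ℝ) ∈ 𝓝 y₀ :=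
    Metric.closedBall_mem_nhds _ (NNReal.coe_pos.2 hr)
  have hcontAt : ContinuousAt α (y₀, 0) :=
    hcont.continuousAt (prod_mem_nhds hball (Icc_mem_nhds (by linarith) hε))
  have hα0 : α (y₀, 0) = y₀ := (hα y₀ (mem_of_mem_nhds hball)).1
  -- Joint continuity of the local flow keeps all curves starting near y₀ in the chart for a common
  -- time; this is what makes the existence time uniform.
  have htarget : ∀ᶠ p : E × ℝ in 𝓝 (y₀, 0), α p ∈ (extChartAt 𝓘(ℝ, E) x₀).target :=
    hcontAt.preimage_mem_nhds
      (by rw [hα0]; exact hopen.mem_nhds (mem_extChartAt_target x₀))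
  rw [nhds_prod_eq] at htarget
  obtain ⟨A, hA, B, hB, hAB⟩ := Filter.eventually_prod_iff.1 htarget
  obtain ⟨δ, hδ, hδB⟩ := Metric.eventually_nhds_iff_ball.1 hB
  have hchart : ContinuousAt (extChartAt 𝓘(ℝ, E) x₀) x₀ := continuousAt_extChartAt x₀
  refine ⟨min ε δ, lt_min hε hδ, ?_⟩
  filter_upwards [hchart.eventually hA, hchart.preimage_mem_nhds hball,
    extChartAt_source_mem_nhds (I := 𝓘(ℝ, E)) x₀] with x hxA hxr hxs
  set y := extChartAt 𝓘(ℝ, E) x₀ x with hy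
  obtain ⟨hα1, hα2⟩ := hα y hxr
  refine ⟨fun t => (extChartAt 𝓘(ℝ, E) x₀).symm (α (y, t)), ?_, fun t ht => ?_⟩
  · simp only [hα1]
    exact PartialEquiv.left_inv _ hxs
  have htε : t ∈ Ioo (-ε) ε :=
    Ioo_subset_Ioo (neg_le_neg (min_le_left _ _)) (min_le_left _ _) ht
  have htδ : t ∈ Metric.ball (0 : ℝ) δ := by
    rw [Real.ball_eq_Ioo]
    simpa using Ioo_subset_Ioo (neg_le_neg (min_le_right ε δ)) (min_le_right ε δ) ht
  let f : ℝ → E := fun t => α (y, t)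
  have hf3' : f t ∈ (extChartAt 𝓘(ℝ, E) x₀).target := hAB hxA (hδB t htδ)
  let xₜ : M := (extChartAt 𝓘(ℝ, E) x₀).symm (f t)
  let vₜ : E := v xₜ
  have h : HasDerivAt f (tangentCoordChange 𝓘(ℝ, E) xₜ x₀ xₜ vₜ) t :=
    (hα2 t (Ioo_subset_Icc_self htε)).hasDerivAt (Icc_mem_nhds htε.1 htε.2)
  have hft1 := mem_preimage.mp <|
    mem_of_mem_of_subset hf3' (extChartAt 𝓘(ℝ, E) x₀).target_subset_preimage_source
  have hft2 := mem_extChartAt_source (I := 𝓘(ℝ, E)) xₜ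
  -- Picard–Lindelöf solves the equation in the chart at x₀, but an integral curve is tested in the
  -- chart at its current point xₜ; the coordinate change transports the velocity.
  have hd : HasDerivAt ((extChartAt 𝓘(ℝ, E) xₜ ∘ (extChartAt 𝓘(ℝ, E) x₀).symm) ∘ f) vₜ t := by
    rw [← tangentCoordChange_self (I := 𝓘(ℝ, E)) (x := xₜ) (z := xₜ) (v := vₜ) hft2,
      ← tangentCoordChange_comp (x := x₀) ⟨⟨hft2, hft1⟩, hft2⟩]
    apply HasFDerivAt.comp_hasDerivAt _ _ h
    apply HasFDerivWithinAt.hasFDerivAt (s := range 𝓘(ℝ, E)) _ (by simp)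
    rw [← (extChartAt 𝓘(ℝ, E) x₀).right_inv hf3']
    exact hasFDerivWithinAt_tangentCoordChange ⟨hft1, hft2⟩
  exact HasMFDerivAt.hasMFDerivWithinAt
    ⟨(continuousAt_extChartAt_symm'' hf3').comp h.continuousAt, hd.hasFDerivAt.hasFDerivWithinAt⟩

/-- If the integral curves through `x` stay in a set `A` on which local integral curves exist for
a uniform time, then there is a global integral curve through `x`. -/
lemma exists_isMIntegralCurve_of_mapsTo [T2Space M]
    (hv : ContMDiff 𝓘(ℝ, E) 𝓘(ℝ, E).tangent 1
      (fun x => (⟨x, v x⟩ : TangentBundle 𝓘(ℝ, E) M)))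
    {A : Set M} {ε : ℝ} (hε : 0 < ε)
    (h : ∀ x ∈ A, ∃ γ : ℝ → M, γ 0 = x ∧
      IsMIntegralCurveOn (I := 𝓘(ℝ, E)) γ v (Ioo (-ε) ε)) {x : M} (hx : x ∈ A)
    (hA : ∀ (γ : ℝ → M) (a : ℝ), γ 0 = x →
      IsMIntegralCurveOn (I := 𝓘(ℝ, E)) γ v (Ioo (-a) a) → ∀ t ∈ Ioo (-a) a, γ t ∈ A) :
    ∃ γ : ℝ → M, γ 0 = x ∧ IsMIntegralCurve (I := 𝓘(ℝ, E)) γ v := by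
  let s := {a | ∃ γ : ℝ → M, γ 0 = x ∧ IsMIntegralCurveOn (I := 𝓘(ℝ, E)) γ v (Ioo (-a) a)}
  suffices hbdd : ¬BddAbove s by
    rw [not_bddAbove_iff] at hbdd
    rw [exists_isMIntegralCurve_iff_exists_isMIntegralCurveOn_Ioo hv]
    intro a
    obtain ⟨y, ⟨γ, hγ1, hγ2⟩, hlt⟩ := hbdd a
    exact ⟨γ, hγ1, hγ2.mono <| Ioo_subset_Ioo (neg_le_neg hlt.le) hlt.le⟩
  intro hbdd
  set T := sSup s with hT
  have hεs : ε ∈ s := h x hx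
  have hεT : ε ≤ T := le_csSup hbdd hεs
  -- A curve of almost maximal half-length is defined at ±(T − ε/2). Gluing local curves of
  -- half-length ε there reaches ±(T + ε/2), beyond the supremum.
  obtain ⟨a, ⟨γ, h0, hγ⟩, hlt⟩ := exists_lt_of_lt_csSup ⟨ε, hεs⟩ (show T - ε / 2 < T by linarith)
  have hmem1 : -(T - ε / 2) ∈ Ioo (-a) a := ⟨by linarith, by linarith⟩
  have hmem2 : T - ε / 2 ∈ Ioo (-a) a := ⟨by linarith, by linarith⟩
  obtain ⟨γ1', h1, hγ1⟩ := h _ (hA γ a h0 hγ _ hmem1)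
  rw [← isMIntegralCurveOn_comp_add (dt := T - ε / 2)] at hγ1
  set γ1 := γ1' ∘ (· + (T - ε / 2)) with γ1_def
  have heq1 : γ1 (-(T - ε / 2)) = γ (-(T - ε / 2)) := by simp [γ1_def, h1]
  obtain ⟨γ2', h2, hγ2⟩ := h _ (hA γ a h0 hγ _ hmem2)
  rw [← isMIntegralCurveOn_comp_sub (dt := T - ε / 2)] at hγ2
  set γ2 := γ2' ∘ (· - (T - ε / 2)) with γ2_def
  have heq2 : γ2 (T - ε / 2) = γ (T - ε / 2) := by simp [γ2_def, h2]
  simp_rw [Set.mem_Ioo, ← sub_lt_iff_lt_add, ← lt_sub_iff_add_lt, ← Set.mem_Ioo] at hγ1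
  simp_rw [Set.mem_Ioo, lt_sub_iff_add_lt, sub_lt_iff_lt_add, ← Set.mem_Ioo] at hγ2
  set γe : ℝ → M := piecewise (Ioo (-(T + ε / 2)) a) (piecewise (Ioo (-a) a) γ γ1) γ2 with γe_def
  have heq : γe 0 = x := by
    rw [γe_def, piecewise, if_pos ⟨by linarith, by linarith⟩, piecewise,
      if_pos ⟨by linarith, by linarith⟩, h0]
  suffices hext : IsMIntegralCurveOn (I := 𝓘(ℝ, E)) γe v (Ioo (-(T + ε / 2)) (T + ε / 2)) from
    (not_lt.mpr <| le_csSup hbdd ⟨γe, heq, hext⟩) <| lt_add_of_pos_right T (half_pos hε)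
  apply (isMIntegralCurveOn_piecewise (t₀ := T - ε / 2) hv _ hγ2
      ⟨⟨by linarith, hlt⟩, ⟨by linarith, by linarith⟩⟩
      (by rw [piecewise, if_pos hmem2, ← heq2])).mono
    (Ioo_subset_Ioo_union_Ioo le_rfl (by linarith) (by linarith))
  exact (isMIntegralCurveOn_piecewise (t₀ := -(T - ε / 2)) hv hγ hγ1
      ⟨hmem1, ⟨by linarith, by linarith⟩⟩ heq1.symm).mono
    (union_comm _ _ ▸ Ioo_subset_Ioo_union_Ioo (by linarith) (by linarith) le_rfl)

omit [IsManifold 𝓘(ℝ, E) 1 M] in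
/-- A function whose derivative along the vector field vanishes is constant on integral curves. -/
lemma eq_of_isMIntegralCurveOn {f : M → ℝ}
    (hf : MDifferentiable 𝓘(ℝ, E) 𝓘(ℝ, ℝ) f)
    (hfv : ∀ x, mfderiv 𝓘(ℝ, E) 𝓘(ℝ, ℝ) f x (v x) = 0) {γ : ℝ → M} {a b : ℝ}
    (hγ : IsMIntegralCurveOn (I := 𝓘(ℝ, E)) γ v (Ioo a b)) {s t : ℝ} (hs : s ∈ Ioo a b)
    (ht : t ∈ Ioo a b) : f (γ s) = f (γ t) := by
  have hd : ∀ u ∈ Ioo a b, HasDerivAt (f ∘ γ) 0 u := by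
    intro u hu
    have h1 := (hf (γ u)).hasMFDerivAt.comp u ((hγ u hu).hasMFDerivAt (Ioo_mem_nhds hu.1 hu.2))
    let D : E →L[ℝ] ℝ := mfderiv 𝓘(ℝ, E) 𝓘(ℝ, ℝ) f (γ u)
    have h2 : HasFDerivAt (f ∘ γ) (D.comp ((1 : ℝ →L[ℝ] ℝ).smulRight (v (γ u) : E))) u :=
      h1.hasFDerivAt
    exact h2.hasDerivAt.congr_deriv
      ((congrArg D (one_smul ℝ (v (γ u) : E))).trans (hfv (γ u)))
  exact isOpen_Ioo.is_const_of_deriv_eq_zero isPreconnected_Ioo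
    (fun u hu => (hd u hu).differentiableAt.differentiableWithinAt)
    (fun u hu => (hd u hu).deriv) hs ht

end IntegralCurves

/-! ### Regularity of the Hamiltonian vector field -/

section Hamiltonian

variable {E : Type*} [NormedAddCommGroup E] [NormedSpace ℝ E] [FiniteDimensional ℝ E]
  {M : Type*} [TopologicalSpace M] [ChartedSpace E M] [IsManifold 𝓘(ℝ, E) ∞ M]

/-- A nondegenerate form on a finite-dimensional space is an isomorphism onto the dual. -/
lemma isInvertible_of_nondegenerate {B : E →L[ℝ] E →L[ℝ] ℝ}
    (hB : ∀ u, (∀ v, B u v = 0) → u = 0) : B.IsInvertible := by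
  have hinj : Function.Injective (B : E →ₗ[ℝ] (E →L[ℝ] ℝ)) := by
    rw [injective_iff_map_eq_zero]
    intro u hu
    exact hB u fun v => congrArg (fun f : E →L[ℝ] ℝ => f v) hu
  have hdim : Module.finrank ℝ E = Module.finrank ℝ (E →L[ℝ] ℝ) := by
    rw [← (LinearMap.toContinuousLinearMap (𝕜 := ℝ) (E := E) (F' := ℝ)).finrank_eq]
    exact (Subspace.dual_finrank_eq (K := ℝ) (V := E)).symm
  refine ⟨(LinearEquiv.ofInjectiveOfFinrankEq _ hinj hdim).toContinuousLinearEquiv, ?_⟩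
  ext u v
  rfl

lemma IsSymplecticForm.isInvertible {Ω : BilinField E M} (hΩ : IsSymplecticForm Ω) (x : M) :
    (Ω x).IsInvertible :=
  isInvertible_of_nondegenerate (E := E) (B := Ω x) (hΩ.nondegenerate x)

omit [FiniteDimensional ℝ E] in
lemma contMDiffAt_differential {H : M → ℝ} (hH : ContMDiff 𝓘(ℝ, E) 𝓘(ℝ, ℝ) ∞ H) (x₀ : M) :
    ContMDiffAt 𝓘(ℝ, E) (𝓘(ℝ, E).prod 𝓘(ℝ, E →L[ℝ] ℝ)) 1
      (fun x : M => Bundle.TotalSpace.mk' (E →L[ℝ] ℝ)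
        (E := fun x : M => TangentSpace 𝓘(ℝ, E) x →L[ℝ] ℝ) x
        (mfderiv 𝓘(ℝ, E) 𝓘(ℝ, ℝ) H x)) x₀ := by
  rw [contMDiffAt_hom_bundle]
  refine ⟨contMDiffAt_id, ?_⟩
  have h := (hH x₀).mfderiv_const (m := 1) (by norm_cast)
  convert h using 1
  ext x v
  simp [inTangentCoordinates, ContinuousLinearMap.inCoordinates]
  rfl

/-- In local trivializations the inverse of Ω is the operator inverse of its coordinate expression,
and operator inversion is smooth near an invertible map. -/
lemma contMDiffAt_symplectic_inverse {Ω : BilinField E M} (hΩ : IsSymplecticForm Ω) (x₀ : M) :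
    ContMDiffAt 𝓘(ℝ, E) 𝓘(ℝ, (E →L[ℝ] ℝ) →L[ℝ] E) 1
      (fun x => ContinuousLinearMap.inCoordinates (E →L[ℝ] ℝ)
        (fun x : M => TangentSpace 𝓘(ℝ, E) x →L[ℝ] ℝ) E (TangentSpace 𝓘(ℝ, E) (M := M))
        x₀ x x₀ x (Ω x).inverse) x₀ := by
  have h := (((contMDiffAt_hom_bundle _).1 (hΩ.smooth x₀)).2).of_le (m := 1) (by norm_cast)
  have h2 : ContMDiffAt 𝓘(ℝ, E) 𝓘(ℝ, (E →L[ℝ] ℝ) →L[ℝ] E) 1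
      (ContinuousLinearMap.inverse ∘ fun x => ContinuousLinearMap.inCoordinates E
        (TangentSpace 𝓘(ℝ, E) (M := M)) (E →L[ℝ] ℝ)
        (fun x : M => TangentSpace 𝓘(ℝ, E) x →L[ℝ] ℝ) x₀ x x₀ x (Ω x)) x₀ := by
    refine ContMDiffAt.comp x₀ ?_ h
    apply ContDiffAt.contMDiffAt
    apply ContinuousLinearMap.IsInvertible.contDiffAt_map_inverse
    rw [ContinuousLinearMap.inCoordinates_eq (FiberBundle.mem_baseSet_trivializationAt' x₀)
      (FiberBundle.mem_baseSet_trivializationAt' x₀)]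
    exact ContinuousLinearMap.isInvertible_equiv.comp
      ((hΩ.isInvertible x₀).comp ContinuousLinearMap.isInvertible_equiv)
  apply h2.congr_of_eventuallyEq
  filter_upwards [(trivializationAt E (TangentSpace 𝓘(ℝ, E)) x₀).open_baseSet.mem_nhds
      (FiberBundle.mem_baseSet_trivializationAt' x₀),
    (trivializationAt (E →L[ℝ] ℝ) (fun x : M => TangentSpace 𝓘(ℝ, E) x →L[ℝ] ℝ)
      x₀).open_baseSet.mem_nhds (FiberBundle.mem_baseSet_trivializationAt' x₀)] with x hx hx'
  rw [Function.comp_apply, ContinuousLinearMap.inCoordinates_eq hx hx',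
    ContinuousLinearMap.inCoordinates_eq hx' hx]
  simp only [ContinuousLinearMap.inverse_equiv_comp, ContinuousLinearMap.inverse_comp_equiv,
    ContinuousLinearEquiv.symm_symm]
  rfl

/-- `hamVF` is chosen pointwise, so its regularity comes from f_H = Ω⁻¹ dH. Class C¹ suffices for
existence and uniqueness of integral curves. -/
lemma contMDiff_hamVF {Ω : BilinField E M} (hΩ : IsSymplecticForm Ω) {H : M → ℝ}
    (hH : ContMDiff 𝓘(ℝ, E) 𝓘(ℝ, ℝ) ∞ H) :
    ContMDiff 𝓘(ℝ, E) 𝓘(ℝ, E).tangent 1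
      (fun x => (⟨x, hamVF Ω H x⟩ : TangentBundle 𝓘(ℝ, E) M)) := by
  intro x₀
  have h := ContMDiffAt.clm_apply_of_inCoordinates (b₁ := id) (b₂ := id)
    (contMDiffAt_symplectic_inverse hΩ x₀) (contMDiffAt_differential hH x₀) contMDiffAt_id
  refine h.congr_of_eventuallyEq (Filter.Eventually.of_forall fun x => ?_)
  refine congrArg (Bundle.TotalSpace.mk' E x) ?_
  refine Eq.symm ((hΩ.isInvertible x).inverse_apply_eq.2 ?_)
  exact ContinuousLinearMap.ext fun w => (hamVF_spec hΩ H x w).symm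

end Hamiltonian

/-! ### Conservation laws and equivariance of the dynamics -/

section Symmetry

variable {E : Type*} [NormedAddCommGroup E] [NormedSpace ℝ E]
  {M : Type*} [TopologicalSpace M] [ChartedSpace E M]

/-- The chain rule for a function that is constant along a curve. -/
lemma mfderiv_apply_curve_eq_zero {f : M → ℝ} (hf : MDifferentiable 𝓘(ℝ, E) 𝓘(ℝ, ℝ) f)
    {c : ℝ → M} (hc : ∀ t, f (c t) = f (c 0)) :
    mfderiv 𝓘(ℝ, E) 𝓘(ℝ, ℝ) f (c 0) (mfderiv 𝓘(ℝ, ℝ) 𝓘(ℝ, E) c 0 (1 : ℝ)) = 0 := by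
  by_cases hd : MDifferentiableAt 𝓘(ℝ, ℝ) 𝓘(ℝ, E) c 0
  · have h1 := (hf (c 0)).hasMFDerivAt.comp (0 : ℝ) hd.hasMFDerivAt
    have h2 : f ∘ c = fun _ => f (c 0) := funext hc
    rw [h2] at h1
    have h3 := hasMFDerivAt_unique h1 (hasMFDerivAt_const (f (c 0)) (0 : ℝ))
    exact congrArg (fun A : ℝ →L[ℝ] ℝ => A 1) h3
  -- At a point of non-differentiability `mfderiv` takes the default value 0, so no regularity of
  -- the curve is needed.
  · rw [mfderiv_zero_of_not_mdifferentiableAt hd]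
    exact map_zero _

/-- Values of a curve's velocity only depend on the curve. -/
lemma mfderiv_curve_apply_one {c : ℝ → M} {t : ℝ} {u : TangentSpace 𝓘(ℝ, E) (c t)}
    (hc : HasMFDerivAt 𝓘(ℝ, ℝ) 𝓘(ℝ, E) c t
      ((1 : ℝ →L[ℝ] ℝ).smulRight u)) :
    mfderiv 𝓘(ℝ, ℝ) 𝓘(ℝ, E) c t (1 : ℝ) = u := by
  rw [hc.mfderiv]
  exact one_smul ℝ u

lemma IsSymplecticForm.neg_swap [IsManifold 𝓘(ℝ, E) ∞ M] {Ω : BilinField E M} (hΩ : IsSymplecticForm Ω) {x : M}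
    (u v : TangentSpace 𝓘(ℝ, E) x) : Ω x u v = -Ω x v u := by
  have h := hΩ.alternating x (u + v)
  simp only [map_add, add_apply, hΩ.alternating] at h
  linarith

/-- Conservation of energy, because Ω is alternating. -/
lemma mfderiv_hamVF_self [IsManifold 𝓘(ℝ, E) ∞ M] [FiniteDimensional ℝ E] {Ω : BilinField E M} (hΩ : IsSymplecticForm Ω)
    (H : M → ℝ) (x : M) :
    mfderiv 𝓘(ℝ, E) 𝓘(ℝ, ℝ) H x (hamVF Ω H x) = 0 :=
  (hamVF_spec hΩ H x _).symm.trans (hΩ.alternating x _)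

lemma expG_zero (ξ : LieG) : expG ξ 0 = 1 := by
  ext1 <;> simp [expG]

lemma expG_zero_smul {M : Type*} [MulAction EucG M] (ξ : LieG) (x : M) : expG ξ 0 • x = x := by
  rw [expG_zero, one_smul]

variable [MulAction EucG M]

lemma contMDiff_const_smul (hsmooth : IsSmoothAction E M) (g : EucG) :
    ContMDiff 𝓘(ℝ, E) 𝓘(ℝ, E) ∞ (fun x : M => g • x) := by
  have h : ContMDiff 𝓘(ℝ, E) ((𝓡 1).prod (𝓘(ℝ, E3).prod ((𝓡 1).prod 𝓘(ℝ, E)))) ∞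
      (fun x : M => ((g.phi, g.a, g.theta, x) : Circle × E3 × Circle × M)) :=
    contMDiff_const.prodMk (contMDiff_const.prodMk (contMDiff_const.prodMk contMDiff_id))
  exact hsmooth.comp h

/-- Invariant functions are constant along the group orbits. -/
lemma mfderiv_generator_eq_zero {H : M → ℝ} (hH : MDifferentiable 𝓘(ℝ, E) 𝓘(ℝ, ℝ) H)
    (hinvH : ∀ (g : EucG) (x : M), H (g • x) = H x) (ξ : LieG) (x : M) :
    mfderiv 𝓘(ℝ, E) 𝓘(ℝ, ℝ) H x (generator E ξ x) = 0 := by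
  have h := mfderiv_apply_curve_eq_zero hH (c := fun t : ℝ => expG ξ t • x)
    fun t => by simp only [hinvH]
  have h0 := expG_zero_smul ξ x
  rw [h0] at h
  exact h

section

variable [IsManifold 𝓘(ℝ, E) ∞ M]

/-- Noether's theorem. -/
lemma mfderiv_momentum_hamVF [FiniteDimensional ℝ E] {Ω : BilinField E M}
    (hΩ : IsSymplecticForm Ω) {H : M → ℝ} (hH : MDifferentiable 𝓘(ℝ, E) 𝓘(ℝ, ℝ) H)
    (hinvH : ∀ (g : EucG) (x : M), H (g • x) = H x) {J : M → (LieG →L[ℝ] ℝ)}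
    (hJ : IsEquivariantMomentumMap Ω J) (ξ : LieG) (x : M) :
    mfderiv 𝓘(ℝ, E) 𝓘(ℝ, ℝ) (fun y => J y ξ) x (hamVF Ω H x) = 0 := by
  have h1 := hJ.momentum ξ x (hamVF Ω H x)
  have h2 := hamVF_spec hΩ H x (generator E ξ x)
  have h3 := mfderiv_generator_eq_zero hH hinvH ξ x
  have h4 := hΩ.neg_swap (generator E ξ x) (hamVF Ω H x)
  exact h1.symm.trans (h4.trans (by rw [h2, h3]; exact neg_zero))

/-- The Hamiltonian vector field of an invariant function is equivariant. -/
lemma hamVF_smul [FiniteDimensional ℝ E] {Ω : BilinField E M} (hΩ : IsSymplecticForm Ω)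
    (hsmooth : IsSmoothAction E M) (hinvΩ : IsInvariantForm Ω) {H : M → ℝ}
    (hH : MDifferentiable 𝓘(ℝ, E) 𝓘(ℝ, ℝ) H) (hinvH : ∀ (g : EucG) (x : M), H (g • x) = H x)
    (g : EucG) (x : M) :
    hamVF Ω H (g • x) = mfderiv 𝓘(ℝ, E) 𝓘(ℝ, E) (fun y : M => g • y) x (hamVF Ω H x) := by
  have hd : ∀ g : EucG, MDifferentiable 𝓘(ℝ, E) 𝓘(ℝ, E) (fun y : M => g • y) := fun g =>
    (contMDiff_const_smul hsmooth g).mdifferentiable (by simp)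
  rw [← sub_eq_zero]
  refine hΩ.nondegenerate _ _ fun v => ?_
  -- The derivative of the action of g is onto, with right inverse coming from g⁻¹. It is enough to
  -- pair with such images, where invariance of Ω and H applies.
  obtain ⟨w, rfl⟩ : ∃ w, mfderiv 𝓘(ℝ, E) 𝓘(ℝ, E) (fun y : M => g • y) x w = v := by
    have h1 := (hd g (g⁻¹ • g • x)).hasMFDerivAt.comp (g • x) (hd g⁻¹ (g • x)).hasMFDerivAt
    have h2 : (fun y : M => g • y) ∘ (fun y : M => g⁻¹ • y) = id := by
      funext y; simp
    rw [h2] at h1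
    have h3 := hasMFDerivAt_unique h1 (hasMFDerivAt_id (g • x))
    have h4 : g⁻¹ • g • x = x := inv_smul_smul g x
    rw [h4] at h3
    exact ⟨_, congrArg (fun A : E →L[ℝ] E => A v) h3⟩
  have h1 := hamVF_spec hΩ H (g • x) (mfderiv 𝓘(ℝ, E) 𝓘(ℝ, E) (fun y : M => g • y) x w)
  have h2 := hamVF_spec hΩ H x w
  have h3 := hinvΩ g x (hamVF Ω H x) w
  have h4 : mfderiv 𝓘(ℝ, E) 𝓘(ℝ, ℝ) H (g • x)
      (mfderiv 𝓘(ℝ, E) 𝓘(ℝ, E) (fun y : M => g • y) x w) = mfderiv 𝓘(ℝ, E) 𝓘(ℝ, ℝ) H x w := by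
    have h5 := (hH (g • x)).hasMFDerivAt.comp x (hd g x).hasMFDerivAt
    have h6 : H ∘ (fun y : M => g • y) = H := funext fun y => hinvH g y
    rw [h6] at h5
    exact congrArg (fun A : E →L[ℝ] ℝ => A w) (hasMFDerivAt_unique h5 (hH x).hasMFDerivAt)
  rw [map_sub, sub_apply, h1, h3, h2]
  exact sub_eq_zero.2 h4

/-- Group translates of integral curves are integral curves. -/
lemma isMIntegralCurveOn_smul [FiniteDimensional ℝ E] {Ω : BilinField E M}
    (hΩ : IsSymplecticForm Ω)
    (hsmooth : IsSmoothAction E M) (hinvΩ : IsInvariantForm Ω) {H : M → ℝ}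
    (hH : MDifferentiable 𝓘(ℝ, E) 𝓘(ℝ, ℝ) H) (hinvH : ∀ (g : EucG) (x : M), H (g • x) = H x)
    {γ : ℝ → M} {s : Set ℝ} (hγ : IsMIntegralCurveOn (I := 𝓘(ℝ, E)) γ (hamVF Ω H) s) (g : EucG) :
    IsMIntegralCurveOn (I := 𝓘(ℝ, E)) (fun t => g • γ t) (hamVF Ω H) s := by
  intro t ht
  have hd : MDifferentiable 𝓘(ℝ, E) 𝓘(ℝ, E) (fun y : M => g • y) :=
    (contMDiff_const_smul hsmooth g).mdifferentiable (by simp)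
  have h1 := (hd (γ t)).hasMFDerivAt.comp_hasMFDerivWithinAt t (hγ t ht)
  have h2 := hamVF_smul hΩ hsmooth hinvΩ hH hinvH g (γ t)
  let D : E →L[ℝ] E := mfderiv 𝓘(ℝ, E) 𝓘(ℝ, E) (fun y : M => g • y) (γ t)
  have e : D.comp ((1 : ℝ →L[ℝ] ℝ).smulRight (hamVF Ω H (γ t) : E)) =
      (1 : ℝ →L[ℝ] ℝ).smulRight (hamVF Ω H (g • γ t) : E) :=
    ContinuousLinearMap.ext fun c =>
      (D.map_smul c (hamVF Ω H (γ t) : E)).trans (congrArg (fun u : E => c • u) h2.symm)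
  exact (congrArg (fun A : ℝ →L[ℝ] E =>
    HasMFDerivWithinAt 𝓘(ℝ, ℝ) 𝓘(ℝ, E) (fun t => g • γ t) s t A) e).mp h1

end

end Symmetry

/-! ### The subgroup `𝒦` -/

/-- The exponential map of the abelian group `𝒦`. -/
noncomputable def expK (κ : LieK) : EucG := ⟨1, κ.1, Circle.exp κ.2⟩

lemma expK_mem (κ : LieK) : expK κ ∈ subgroupK := rfl

lemma expK_zero : expK 0 = 1 := by
  ext1 <;> simp [expK]

lemma expK_add (κ κ' : LieK) : expK (κ + κ') = expK κ * expK κ' := by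
  ext1 <;> simp [expK, rot_one, Circle.exp_add]

lemma expG_inr (κ : LieK) (t : ℝ) : expG (0, κ) t = expK (t • κ) := by
  ext1 <;> simp [expG, expK, rot_one]

lemma isClosed_subgroupK : IsClosed (subgroupK : Set EucG) := by
  have h : Continuous fun g : EucG => (g.phi, g.a, g.theta) := continuous_induced_dom
  exact isClosed_singleton.preimage h.fst

/-- The group 𝒦 is abelian. -/
lemma Ad_inr_of_mem_subgroupK {g : EucG} (hg : g ∈ subgroupK) (κ : LieK) : Ad g (0, κ) = (0, κ) := by
  have h : g.phi = 1 := hg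
  simp [Ad, h, rot_one]

section

variable {E : Type*} [NormedAddCommGroup E] [NormedSpace ℝ E]
  {M : Type*} [TopologicalSpace M] [ChartedSpace E M] [MulAction EucG M]

lemma contMDiff_expK_smul (hsmooth : IsSmoothAction E M) :
    ContMDiff (𝓘(ℝ, LieK).prod 𝓘(ℝ, E)) 𝓘(ℝ, E) ∞ (fun p : LieK × M => expK p.1 • p.2) := by
  have h1 : ContMDiff (𝓘(ℝ, LieK).prod 𝓘(ℝ, E)) 𝓘(ℝ, E3) ∞ (fun p : LieK × M => p.1.1) :=
    (contDiff_fst (𝕜 := ℝ) (E := E3) (F := ℝ)).contMDiff.comp contMDiff_fst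
  have h2 : ContMDiff (𝓘(ℝ, LieK).prod 𝓘(ℝ, E)) (𝓡 1) ∞
      (fun p : LieK × M => Circle.exp p.1.2) :=
    contMDiff_circleExp.comp
      ((contDiff_snd (𝕜 := ℝ) (E := E3) (F := ℝ)).contMDiff.comp contMDiff_fst)
  have h : ContMDiff (𝓘(ℝ, LieK).prod 𝓘(ℝ, E))
      ((𝓡 1).prod (𝓘(ℝ, E3).prod ((𝓡 1).prod 𝓘(ℝ, E)))) ∞
      (fun p : LieK × M => (((1 : Circle), p.1.1, Circle.exp p.1.2, p.2) :
        Circle × E3 × Circle × M)) :=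
    contMDiff_const.prodMk (h1.prodMk (h2.prodMk contMDiff_snd))
  exact hsmooth.comp h

lemma contMDiff_expK_smul_const (hsmooth : IsSmoothAction E M) (x : M) :
    ContMDiff 𝓘(ℝ, LieK) 𝓘(ℝ, E) ∞ (fun κ : LieK => expK κ • x) :=
  (contMDiff_expK_smul hsmooth).comp (contMDiff_id.prodMk contMDiff_const)

variable (E) in
/-- The infinitesimal action of `𝔨` at `x`. -/
noncomputable def generatorK (x : M) : LieK →L[ℝ] E :=
  mfderiv 𝓘(ℝ, LieK) 𝓘(ℝ, E) (fun κ : LieK => expK κ • x) 0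

/-- The one-parameter groups of 𝒦 are lines in 𝔨 followed by `expK`, so all generators come from one
derivative; in particular they are linear in κ. -/
lemma generator_inr (hsmooth : IsSmoothAction E M) (κ : LieK) (x : M) :
    generator E (0, κ) x = generatorK E x κ := by
  have h1 : HasMFDerivAt 𝓘(ℝ, ℝ) 𝓘(ℝ, LieK) (fun t : ℝ => t • κ) 0
      ((1 : ℝ →L[ℝ] ℝ).smulRight κ) :=
    ((1 : ℝ →L[ℝ] ℝ).smulRight κ).hasFDerivAt.hasMFDerivAt
  have h2 := ((contMDiff_expK_smul_const hsmooth x).mdifferentiable (by simp)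
    ((0 : ℝ) • κ)).hasMFDerivAt.comp (0 : ℝ) h1
  have h3 : (fun κ : LieK => expK κ • x) ∘ (fun t : ℝ => t • κ) =
      fun t : ℝ => expG (0, κ) t • x := by
    funext t
    simp [expG_inr]
  rw [h3] at h2
  have h5 := congrArg (fun A : ℝ →L[ℝ] E => A 1) h2.mfderiv
  refine h5.trans ?_
  have h6 : ∀ κ₀ : LieK, κ₀ = 0 →
      (mfderiv 𝓘(ℝ, LieK) 𝓘(ℝ, E) (fun κ : LieK => expK κ • x) κ₀ : LieK →L[ℝ] E) =
        generatorK E x := by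
    rintro _ rfl
    rfl
  have h7 := h6 ((0 : ℝ) • κ) (zero_smul ℝ κ)
  refine Eq.trans ?_ (congrArg (fun A : LieK →L[ℝ] E => A κ) h7)
  exact congrArg (mfderiv 𝓘(ℝ, LieK) 𝓘(ℝ, E) (fun κ : LieK => expK κ • x) ((0 : ℝ) • κ) :
    LieK →L[ℝ] E) (one_smul ℝ κ)

/-- A point at which a generator of `𝒦` vanishes is fixed by its one-parameter group. -/
lemma expK_smul_eq_of_generator_eq_zero [IsManifold 𝓘(ℝ, E) ∞ M] [T2Space M]
    (hsmooth : IsSmoothAction E M) {κ : LieK} {x : M} (h : generator E (0, κ) x = 0) (t : ℝ) :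
    expK (t • κ) • x = x := by
  let c : ℝ → M := fun t => expK (t • κ) • x
  have hcd : MDifferentiable 𝓘(ℝ, ℝ) 𝓘(ℝ, E) c := by
    have h1 : ContMDiff 𝓘(ℝ, ℝ) 𝓘(ℝ, LieK) ∞ (fun t : ℝ => t • κ) :=
      (contDiff_id.smul contDiff_const).contMDiff
    exact ((contMDiff_expK_smul_const hsmooth x).comp h1).mdifferentiable (by simp)
  have hc0 : HasMFDerivAt 𝓘(ℝ, ℝ) 𝓘(ℝ, E) c 0 (0 : ℝ →L[ℝ] E) := by
    have h1 := (hcd 0).hasMFDerivAt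
    have h2 : (mfderiv 𝓘(ℝ, ℝ) 𝓘(ℝ, E) c 0 : ℝ →L[ℝ] E) = 0 := by
      have h3 : c = fun t => expG (0, κ) t • x := by funext t; simp only [c, expG_inr]
      ext
      rw [h3]
      exact h
    exact (congrArg (fun A : ℝ →L[ℝ] E => HasMFDerivAt 𝓘(ℝ, ℝ) 𝓘(ℝ, E) c 0 A) h2).mp h1
  -- By the group law c is near t the translate of c near 0, so its vanishing velocity at 0
  -- propagates to every t. Uniqueness for the zero vector field then makes c constant.
  have hct : IsMIntegralCurve (I := 𝓘(ℝ, E)) c (fun _ => 0) := by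
    intro t
    have h1 : c = (fun y : M => expK (t • κ) • y) ∘ c ∘ (fun s => s - t) := by
      funext s
      simp only [c, Function.comp, smul_smul, ← expK_add, ← add_smul]
      congr 3
      ring
    have h2 : HasMFDerivAt 𝓘(ℝ, ℝ) 𝓘(ℝ, ℝ) (fun s : ℝ => s - t) t (ContinuousLinearMap.id ℝ ℝ) :=
      ((hasFDerivAt_id t).sub_const t).hasMFDerivAt
    have hc0' : HasMFDerivAt 𝓘(ℝ, ℝ) 𝓘(ℝ, E) c (t - t) (0 : ℝ →L[ℝ] E) := by
      rw [sub_self]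
      exact hc0
    have h3 := (((contMDiff_const_smul hsmooth (expK (t • κ))).mdifferentiable (by simp))
      (c (t - t))).hasMFDerivAt.comp t (HasMFDerivAt.comp (g := c) (f := fun s => s - t) t hc0' h2)
    rw [← h1] at h3
    let D : E →L[ℝ] E :=
      mfderiv 𝓘(ℝ, E) 𝓘(ℝ, E) (fun y : M => expK (t • κ) • y) (c (t - t))
    have e : D.comp ((0 : ℝ →L[ℝ] E).comp (ContinuousLinearMap.id ℝ ℝ)) =
        (1 : ℝ →L[ℝ] ℝ).smulRight (0 : E) := by
      ext
      simp
    exact (congrArg (fun A : ℝ →L[ℝ] E => HasMFDerivAt 𝓘(ℝ, ℝ) 𝓘(ℝ, E) c t A) e).mp h3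
  have hconst : IsMIntegralCurve (I := 𝓘(ℝ, E)) (fun _ : ℝ => x) (fun _ => 0) := by
    intro t
    have e : (0 : ℝ →L[ℝ] E) = (1 : ℝ →L[ℝ] ℝ).smulRight (0 : E) := by
      ext
      simp
    exact (congrArg (fun A : ℝ →L[ℝ] E => HasMFDerivAt 𝓘(ℝ, ℝ) 𝓘(ℝ, E) (fun _ : ℝ => x) t A)
      e).mp (hasMFDerivAt_const x t)
  have hzero : ContMDiff 𝓘(ℝ, E) 𝓘(ℝ, E).tangent 1
      (fun x : M => (⟨x, 0⟩ : TangentBundle 𝓘(ℝ, E) M)) :=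
    Bundle.contMDiff_zeroSection ℝ (TangentSpace 𝓘(ℝ, E) : M → Type _)
  have : IsManifold 𝓘(ℝ, E) 1 M := .of_le (n := ∞) (by norm_cast)
  have heq := isMIntegralCurve_Ioo_eq_of_contMDiff_boundaryless (t₀ := 0) hzero hct hconst
    (by simp [c, expK_zero])
  exact congrFun heq t

/-- The action of `𝒦` is locally free at an axisymmetric point. -/
lemma generator_injective_of_isAxisymmetric [IsManifold 𝓘(ℝ, E) ∞ M] [T2Space M]
    (hsmooth : IsSmoothAction E M) {κ : LieK} {x : M} (hx : IsAxisymmetric M x)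
    (h : generator E (0, κ) x = 0) : κ = 0 := by
  have hmem : ∀ t : ℝ, expK (t • κ) ∈ subgroupD := fun t => by
    rw [← hx]
    exact expK_smul_eq_of_generator_eq_zero hsmooth h t
  have h1 : κ.1 = 0 := by simpa [expK] using (hmem 1).1
  have h2 : κ.2 = 0 := by
    by_contra h2
    -- At time π/κ.2 the angle θ is π while φ stays 0, so membership in SO(2)_D would force 1 = −1.
    have h3 : (1 : Circle) = Circle.exp ((Real.pi / κ.2) * κ.2) := (hmem (Real.pi / κ.2)).2
    rw [div_mul_cancel₀ _ h2] at h3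
    have h4 := congrArg (fun z : Circle => (z : ℂ)) h3
    simp at h4
    norm_num at h4
  exact Prod.ext h1 h2

end

/-! ### Behaviour of the momenta along 𝒦-orbits -/

section Momentum

variable {M : Type*} [MulAction EucG M] {J : M → (LieG →L[ℝ] ℝ)}

variable (hequiv : ∀ (g : EucG) (x : M) (ξ : LieG), J (g • x) (Ad g ξ) = J x ξ)
include hequiv

/-- `J^𝒦` is invariant under the abelian group `𝒦`. -/
lemma momentumK_smul {k : EucG} (hk : k ∈ subgroupK) (x : M) :
    momentumK J (k • x) = momentumK J x := by
  refine ContinuousLinearMap.ext fun κ => ?_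
  have h := hequiv k x (0, κ)
  rw [Ad_inr_of_mem_subgroupK hk] at h
  exact h

/-- At an axisymmetric point, `J^a` is parallel to the symmetry axis. -/
lemma momentum_hatE3_eq_zero {x : M} (hx : IsAxisymmetric M x) (a : E3) :
    J x (0, (hatE3 a, 0)) = 0 := by
  -- Rotation by π in SO(2)_D fixes x and negates horizontal vectors, in particular `hatE3 a`.
  let g : EucG := ⟨Circle.exp Real.pi, 0, Circle.exp Real.pi⟩
  have hg : g • x = x := by
    have : g ∈ MulAction.stabilizer EucG x := by
      rw [hx]
      exact ⟨rfl, rfl⟩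
    exact this
  have h := hequiv g x (0, (hatE3 a, 0))
  rw [hg] at h
  have e : Ad g (0, (hatE3 a, 0)) = -(0, (hatE3 a, 0)) := by
    refine Prod.ext (by simp [Ad]) (Prod.ext ?_ (by simp [Ad]))
    ext i
    fin_cases i <;> simp [Ad, g, rot_apply, hatE3]
  rw [e, map_neg] at h
  linarith

/-- On the level set of `J^𝒦` through an axisymmetric point, `J^{SO(2)_D}` is `𝒦`-invariant. -/
lemma momentumD_smul {x y : M} (hx : IsAxisymmetric M x) (hy : momentumK J y = momentumK J x)
    {k : EucG} (hk : k ∈ subgroupK) : momentumD J (k • y) = momentumD J y := by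
  have hk1 : k.phi = 1 := hk
  have h := hequiv k y (1, 0, 1)
  -- The correction is J^a evaluated at ê₃a; at k • y the momentum J^a equals that at x, which is
  -- axial.
  have e : Ad k (1, 0, 1) = (1, 0, 1) - (0, (hatE3 k.a, 0)) := by
    simp [Ad]
  have h0 : J (k • y) (0, (hatE3 k.a, 0)) = 0 := by
    have h1 := congrArg (fun A : LieK →L[ℝ] ℝ => A (hatE3 k.a, 0))
      ((momentumK_smul hequiv hk y).trans hy)
    exact h1.trans (momentum_hatE3_eq_zero hequiv hx k.a)
  rw [e, map_sub, h0, sub_zero] at h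
  exact h

end Momentum

/-! ### Manifold derivatives read in a chart -/

section Charts

variable {E : Type*} [NormedAddCommGroup E] [NormedSpace ℝ E]
  {M : Type*} [TopologicalSpace M] [ChartedSpace E M]
  {F : Type*} [NormedAddCommGroup F] [NormedSpace ℝ F]

lemma mfderiv_eq_fderiv_chart {f : M → F} {x : M} (hf : MDifferentiableAt 𝓘(ℝ, E) 𝓘(ℝ, F) f x) :
    mfderiv 𝓘(ℝ, E) 𝓘(ℝ, F) f x =
      fderiv ℝ (f ∘ (extChartAt 𝓘(ℝ, E) x).symm) (extChartAt 𝓘(ℝ, E) x x) := by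
  let D : E →L[ℝ] F := mfderiv 𝓘(ℝ, E) 𝓘(ℝ, F) f x
  have h : HasFDerivWithinAt (f ∘ (extChartAt 𝓘(ℝ, E) x).symm) D (range 𝓘(ℝ, E))
    (extChartAt 𝓘(ℝ, E) x x) := hf.hasMFDerivAt.2
  exact (h.hasFDerivAt (by simp)).fderiv.symm

lemma mfderiv_eq_of_hasFDerivAt_chart {f : F → M} {w₀ : F} {x : M} (hx : f w₀ = x)
    (hf : ContinuousAt f w₀) {D : F →L[ℝ] E}
    (hD : HasFDerivAt (extChartAt 𝓘(ℝ, E) x ∘ f) D w₀) :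
    mfderiv 𝓘(ℝ, F) 𝓘(ℝ, E) f w₀ = D := by
  subst hx
  have h : HasMFDerivAt 𝓘(ℝ, F) 𝓘(ℝ, E) f w₀ D := by
    exact ⟨hf, hD.hasFDerivWithinAt⟩
  exact h.mfderiv

end Charts

/-! ### J^𝒦 as a submersion and the slice theorem -/

section Slice

variable {E : Type*} [NormedAddCommGroup E] [NormedSpace ℝ E]
  {M : Type*} [TopologicalSpace M] [ChartedSpace E M] [IsManifold 𝓘(ℝ, E) ∞ M]
  [MulAction EucG M] {Ω : BilinField E M} {J : M → (LieG →L[ℝ] ℝ)}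

omit [IsManifold 𝓘(ℝ, E) ∞ M] in
lemma IsEquivariantMomentumMap.contMDiff_momentumK (hJ : IsEquivariantMomentumMap Ω J) :
    ContMDiff 𝓘(ℝ, E) 𝓘(ℝ, LieK →L[ℝ] ℝ) ∞ (momentumK J) :=
  ((ContinuousLinearMap.compL ℝ LieK LieG ℝ).flip
    (ContinuousLinearMap.inr ℝ ℝ LieK)).contDiff.contMDiff.comp hJ.smooth

omit [IsManifold 𝓘(ℝ, E) ∞ M] in
lemma IsEquivariantMomentumMap.contMDiff_apply (hJ : IsEquivariantMomentumMap Ω J) (ξ : LieG) :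
    ContMDiff 𝓘(ℝ, E) 𝓘(ℝ, ℝ) ∞ (fun x => J x ξ) :=
  (ContinuousLinearMap.apply ℝ ℝ ξ).contDiff.contMDiff.comp hJ.smooth

variable (E) in
/-- The derivative of `J^𝒦` at `x`. -/
noncomputable def derivMomentumK (J : M → (LieG →L[ℝ] ℝ)) (x : M) : E →L[ℝ] LieK →L[ℝ] ℝ :=
  mfderiv 𝓘(ℝ, E) 𝓘(ℝ, LieK →L[ℝ] ℝ) (momentumK J) x

omit [IsManifold 𝓘(ℝ, E) ∞ M] in
/-- `DJ(x)`, as a linear map on the model space. -/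
lemma IsEquivariantMomentumMap.exists_linear (hJ : IsEquivariantMomentumMap Ω J) (x : M) :
    ∃ A : E →L[ℝ] LieG →L[ℝ] ℝ, ∀ ξ (w : E),
      mfderiv 𝓘(ℝ, E) 𝓘(ℝ, ℝ) (fun y => J y ξ) x w = A w ξ := by
  have hJx := (hJ.smooth.mdifferentiable (by simp) x).hasMFDerivAt
  refine ⟨mfderiv 𝓘(ℝ, E) 𝓘(ℝ, LieG →L[ℝ] ℝ) J x, fun ξ w => ?_⟩
  have h := (ContinuousLinearMap.apply ℝ ℝ ξ).hasFDerivAt.hasMFDerivAt.comp x hJx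
  exact congrArg (fun A : E →L[ℝ] ℝ => A w) h.mfderiv

omit [IsManifold 𝓘(ℝ, E) ∞ M] in
lemma IsEquivariantMomentumMap.derivMomentumK_apply (hJ : IsEquivariantMomentumMap Ω J)
    (x : M) (w : E) (κ : LieK) :
    derivMomentumK E J x w κ =
      mfderiv 𝓘(ℝ, E) 𝓘(ℝ, ℝ) (fun y => J y (0, κ)) x w := by
  have hJx := (hJ.contMDiff_momentumK.mdifferentiable (by simp) x).hasMFDerivAt
  have h := (ContinuousLinearMap.apply ℝ ℝ κ).hasFDerivAt.hasMFDerivAt.comp x hJx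
  exact (congrArg (fun A : E →L[ℝ] ℝ => A w) h.mfderiv).symm

/-- `J^𝒦` is a submersion at points where `𝒦` acts locally freely. -/
lemma IsEquivariantMomentumMap.surjective_derivMomentumK
    (hJ : IsEquivariantMomentumMap Ω J) (hΩ : IsSymplecticForm Ω) {x : M}
    (hfree : ∀ κ : LieK, generator E (0, κ) x = 0 → κ = 0) :
    Function.Surjective
      (derivMomentumK E J x) := by
  set L := derivMomentumK E J x with hL
  let B : E →ₗ[ℝ] Module.Dual ℝ LieK :=
    (LinearMap.toContinuousLinearMap (𝕜 := ℝ) (E := LieK) (F' := ℝ)).symm.toLinearMap ∘ₗ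
      (L : E →ₗ[ℝ] (LieK →L[ℝ] ℝ))
  -- Through Ω, the derivative of J^𝒦 is dual to κ ↦ κ x. Injectivity of the latter gives
  -- surjectivity of the former, as 𝔨 is finite-dimensional.
  have hB : ∀ w κ, B w κ = Ω x (generator E (0, κ) x) w := fun w κ =>
    (hJ.derivMomentumK_apply x w κ).trans (hJ.momentum (0, κ) x w).symm
  have hinj : Function.Injective B.flip := by
    rw [injective_iff_map_eq_zero]
    intro κ hκ
    refine hfree κ (hΩ.nondegenerate x _ fun w => ?_)
    rw [← hB w κ]
    exact LinearMap.congr_fun hκ w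
  have hsurj : Function.Surjective B := LinearMap.flip_injective_iff₂.1 hinj
  intro n
  obtain ⟨w, hw⟩ := hsurj (n : LieK →ₗ[ℝ] ℝ)
  refine ⟨w, ?_⟩
  refine ContinuousLinearMap.ext fun κ => ?_
  exact LinearMap.congr_fun hw κ

omit [IsManifold 𝓘(ℝ, E) ∞ M] in
-- J^𝒦 is constant along 𝒦-orbits, so 𝔨 x lies in the kernel of its derivative.
lemma IsEquivariantMomentumMap.derivMomentumK_generatorK
    (hJ : IsEquivariantMomentumMap Ω J) (hsmooth : IsSmoothAction E M) (x : M) (κ : LieK) :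
    (derivMomentumK E J x)
      (generatorK E x κ) = 0 := by
  refine ContinuousLinearMap.ext fun κ' => ?_
  refine (hJ.derivMomentumK_apply x (generatorK E x κ) κ').trans ?_
  rw [← generator_inr hsmooth]
  have h := mfderiv_apply_curve_eq_zero (f := fun y => J y (0, κ'))
    ((hJ.contMDiff_apply (0, κ')).mdifferentiable (by simp)) (c := fun t : ℝ => expG (0, κ) t • x)
    fun t => by
      have h1 : ∀ t, J (expG (0, κ) t • x) (0, κ') = J x (0, κ') := fun t => by
        rw [expG_inr]
        exact congrArg (fun A : LieK →L[ℝ] ℝ => A κ')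
          (momentumK_smul hJ.equivariant (expK_mem (t • κ)) x)
      rw [h1, h1]
  rw [expG_zero_smul (0, κ) x] at h
  exact h

/-- The map `(κ, u) ↦ exp(κ) R(u)` in a chart has the derivative `κ x + u`. -/
lemma hasStrictFDerivAt_expK_smul_chart (hsmooth : IsSmoothAction E M) (x : M) {R : E → E}
    (hR : ContDiffAt ℝ ∞ R 0) (hR0 : R 0 = extChartAt 𝓘(ℝ, E) x x)
    (hR' : HasFDerivAt R (ContinuousLinearMap.id ℝ E) 0) :
    HasStrictFDerivAt (fun p : LieK × E => extChartAt 𝓘(ℝ, E) x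
      (expK p.1 • (extChartAt 𝓘(ℝ, E) x).symm (R p.2)))
      ((generatorK E x).coprod (ContinuousLinearMap.id ℝ E)) 0 ∧
    ContinuousAt (fun p : LieK × E => expK p.1 • (extChartAt 𝓘(ℝ, E) x).symm (R p.2)) 0 := by
  set φ := extChartAt 𝓘(ℝ, E) x with hφ
  have hsymm0 : φ.symm (R 0) = x := by rw [hR0]; exact extChartAt_to_inv x
  have hsymm : ContMDiffAt 𝓘(ℝ, E) 𝓘(ℝ, E) ∞ φ.symm (R 0) := by
    rw [hR0]
    exact (contMDiffOn_extChartAt_symm x).contMDiffAt (extChartAt_target_mem_nhds x)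
  have hRsnd : ContMDiffAt 𝓘(ℝ, LieK × E) 𝓘(ℝ, E) ∞ (fun p : LieK × E => R p.2) 0 :=
    ContDiffAt.contMDiffAt (ContDiffAt.comp (0 : LieK × E) hR contDiff_snd.contDiffAt)
  have h1 : ContMDiffAt 𝓘(ℝ, LieK × E) (𝓘(ℝ, LieK).prod 𝓘(ℝ, E)) ∞
      (fun p : LieK × E => ((p.1, φ.symm (R p.2)) : LieK × M)) 0 :=
    (contDiff_fst.contMDiff.contMDiffAt).prodMk
      (ContMDiffAt.comp (0 : LieK × E) hsymm hRsnd)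
  have h2 : ContMDiffAt 𝓘(ℝ, LieK × E) 𝓘(ℝ, E) ∞
      (fun p : LieK × E => expK p.1 • φ.symm (R p.2)) 0 :=
    (contMDiff_expK_smul hsmooth).contMDiffAt.comp (0 : LieK × E) h1
  have h20 : expK (0 : LieK × E).1 • φ.symm (R (0 : LieK × E).2) = x := by
    simp [expK_zero, hsymm0]
  have h3 : ContMDiffAt 𝓘(ℝ, LieK × E) 𝓘(ℝ, E) ∞
      (fun p : LieK × E => φ (expK p.1 • φ.symm (R p.2))) 0 := by
    refine ContMDiffAt.comp (0 : LieK × E) (g := φ) ?_ h2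
    rw [h20]
    exact contMDiffAt_extChartAt
  refine ⟨?_, h2.continuousAt⟩
  have h4 := h3.contDiffAt.hasStrictFDerivAt (by simp)
  set D := fderiv ℝ (fun p : LieK × E => φ (expK p.1 • φ.symm (R p.2))) 0
  have h5 := h4.hasFDerivAt
  -- D is determined by its restrictions to the two axes: for u = 0 the map is the orbit map through
  -- x, for κ = 0 it is R.
  have hl : HasFDerivAt (φ ∘ fun κ : LieK => expK κ • x)
      (D.comp (ContinuousLinearMap.inl ℝ LieK E)) 0 := by
    have := HasFDerivAt.comp (0 : LieK)
      (g := fun p : LieK × E => φ (expK p.1 • φ.symm (R p.2))) (g' := D)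
      (by rw [map_zero]; exact h5) (ContinuousLinearMap.inl ℝ LieK E).hasFDerivAt
    refine this.congr_of_eventuallyEq (Filter.Eventually.of_forall fun κ => ?_)
    simp [hsymm0]
  have hl' : generatorK E x = D.comp (ContinuousLinearMap.inl ℝ LieK E) :=
    mfderiv_eq_of_hasFDerivAt_chart (by simp [expK_zero])
      (contMDiff_expK_smul_const hsmooth x).continuous.continuousAt hl
  have hr : HasFDerivAt R (D.comp (ContinuousLinearMap.inr ℝ LieK E)) 0 := by
    have := HasFDerivAt.comp (0 : E)
      (g := fun p : LieK × E => φ (expK p.1 • φ.symm (R p.2))) (g' := D)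
      (by rw [map_zero]; exact h5) (ContinuousLinearMap.inr ℝ LieK E).hasFDerivAt
    refine this.congr_of_eventuallyEq ?_
    have htar : ∀ᶠ u in 𝓝 (0 : E), R u ∈ φ.target :=
      hR.continuousAt.preimage_mem_nhds (by rw [hR0]; exact extChartAt_target_mem_nhds x)
    filter_upwards [htar] with u hu
    simp [expK_zero, φ.right_inv hu]
  have hr' := hR'.unique hr
  have e : (generatorK E x).coprod (ContinuousLinearMap.id ℝ E) = D := by
    rw [hl', hr']
    ext p <;> simp
  rw [e]
  exact h4

/-- Slice theorem for the action of `𝒦` on a level set of `J^𝒦`: there is a reduced slice whose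
`𝒦`-translates fill a neighbourhood in the level set. -/
lemma exists_isReducedSlice [FiniteDimensional ℝ E] (hJ : IsEquivariantMomentumMap Ω J)
    (hΩ : IsSymplecticForm Ω) (hsmooth : IsSmoothAction E M) {x : M}
    (hfree : ∀ κ : LieK, generator E (0, κ) x = 0 → κ = 0) :
    ∃ (d : ℕ) (σ : EuclideanSpace ℝ (Fin d) → M), IsReducedSlice E J x σ ∧
      ∀ N ∈ 𝓝 (0 : EuclideanSpace ℝ (Fin d)), ∀ᶠ y in 𝓝 x, momentumK J y = momentumK J x →
        ∃ k ∈ subgroupK, ∃ w ∈ N, y = k • σ w := by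
  set φ := extChartAt 𝓘(ℝ, E) x with hφ
  set y₀ := φ x with hy₀
  have hmd := hJ.contMDiff_momentumK.mdifferentiable (by simp) x
  have hsurj := hJ.surjective_derivMomentumK hΩ hfree
  have hLG := hJ.derivMomentumK_generatorK hsmooth x
  have hLeq : derivMomentumK E J x = _ := mfderiv_eq_fderiv_chart hmd
  let f : E → (LieK →L[ℝ] ℝ) := momentumK J ∘ φ.symm
  have hsymm : ContMDiffAt 𝓘(ℝ, E) 𝓘(ℝ, E) ∞ φ.symm y₀ :=
    (contMDiffOn_extChartAt_symm x).contMDiffAt (extChartAt_target_mem_nhds x)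
  have hsymm0 : φ.symm y₀ = x := extChartAt_to_inv x
  have hf : ContDiffAt ℝ ∞ f y₀ :=
    (hJ.contMDiff_momentumK.contMDiffAt.comp y₀ hsymm).contDiffAt
  set L : E →L[ℝ] LieK →L[ℝ] ℝ := fderiv ℝ f y₀ with hL
  have hLsurj : Function.Surjective L := by
    rwa [hLeq] at hsurj
  have hLG' : ∀ κ, L (generatorK E x κ) = 0 := fun κ =>
    (congrArg (fun A : E →L[ℝ] LieK →L[ℝ] ℝ => A (generatorK E x κ)) hLeq).symm.trans (hLG κ)
  obtain ⟨R, hR, hR0, hR', hRL⟩ := exists_straightening hf hLsurj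
  obtain ⟨d, ι, hι, hspan, htrans⟩ := exists_euclidean_complement L (generatorK E x)
  have hf0 : f y₀ = momentumK J x := congrArg (momentumK J) hsymm0
  have hσ0 : φ.symm (R (ι 0)) = x := by rw [map_zero, hR0, hsymm0]
  have hRι : ContDiffAt ℝ ∞ (fun w => R (ι w)) 0 :=
    ContDiffAt.comp 0 (by rwa [map_zero]) ι.contDiff.contDiffAt
  have hσ : ContMDiffAt 𝓘(ℝ, EuclideanSpace ℝ (Fin d)) 𝓘(ℝ, E) ∞
      (fun w => φ.symm (R (ι w))) 0 :=
    ContMDiffAt.comp 0 (by rwa [map_zero, hR0]) hRι.contMDiffAt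
  have hder : derivAtZero E x (fun w => φ.symm (R (ι w))) = ι := by
    refine mfderiv_eq_of_hasFDerivAt_chart (f := fun w => φ.symm (R (ι w))) hσ0 hσ.continuousAt ?_
    have h1 : HasFDerivAt (fun w => R (ι w)) ι 0 := by
      have := HasFDerivAt.comp (0 : EuclideanSpace ℝ (Fin d)) (g := R)
        (g' := ContinuousLinearMap.id ℝ E) (by rwa [map_zero]) ι.hasFDerivAt
      simpa [Function.comp_def] using this
    refine h1.congr_of_eventuallyEq ?_
    have htar : ∀ᶠ w in 𝓝 (0 : EuclideanSpace ℝ (Fin d)), R (ι w) ∈ φ.target :=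
      hRι.continuousAt.preimage_mem_nhds
        (by rw [map_zero, hR0]; exact extChartAt_target_mem_nhds x)
    filter_upwards [htar] with w hw
    exact φ.right_inv hw
  have hιtend : Filter.Tendsto ι (𝓝 0) (𝓝 0) := by
    simpa using ι.continuous.tendsto 0
  refine ⟨d, fun w => φ.symm (R (ι w)), ⟨hσ, hσ0, ?_, ?_, ?_⟩, ?_⟩
  · filter_upwards [hιtend.eventually hRL] with w hw
    have : f (R (ι w)) = f y₀ := by rw [hw, hι, add_zero]
    exact this.trans hf0
  · intro v
    have h1 : mfderiv 𝓘(ℝ, E) 𝓘(ℝ, LieK →L[ℝ] ℝ) (momentumK J) x v = L v :=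
      congrArg (fun A : E →L[ℝ] LieK →L[ℝ] ℝ => A v) hLeq
    rw [h1, hder]
    constructor
    · intro hv
      obtain ⟨w, κ, h⟩ := hspan v hv
      exact ⟨w, κ, h.trans (congrArg (fun u : E => ι w + u) (generator_inr hsmooth κ x).symm)⟩
    · rintro ⟨w, κ, h⟩
      have h' : v = ι w + generatorK E x κ :=
        h.trans (congrArg (fun u : E => ι w + u) (generator_inr hsmooth κ x))
      refine (congrArg L h').trans ?_
      rw [map_add, hι, hLG', add_zero]
      rfl
  · intro w κ h
    rw [hder] at h
    exact htrans w κ (h.trans (generator_inr hsmooth κ x))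
  · intro N hN
    obtain ⟨j₀, hj₀⟩ := (L : E →ₗ[ℝ] (LieK →L[ℝ] ℝ)).exists_rightInverse_of_surjective
      (LinearMap.range_eq_top.2 hLsurj)
    let j : (LieK →L[ℝ] ℝ) →L[ℝ] E := LinearMap.toContinuousLinearMap j₀
    have hj : ∀ n, L (j n) = n := fun n => LinearMap.congr_fun hj₀ n
    -- The variable n parametrizes directions transverse to the level set. With it the derivative κ
    -- x + ι w + j n is onto, so images of neighbourhoods of 0 are neighbourhoods of y₀.
    let P : LieK × EuclideanSpace ℝ (Fin d) × (LieK →L[ℝ] ℝ) →L[ℝ] LieK × E :=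
      (ContinuousLinearMap.id ℝ LieK).prodMap (ι.coprod j)
    obtain ⟨hΨ, hΨc⟩ := hasStrictFDerivAt_expK_smul_chart hsmooth x hR hR0 hR'
    have hΨP := HasStrictFDerivAt.comp (0 : LieK × EuclideanSpace ℝ (Fin d) × (LieK →L[ℝ] ℝ))
      (by rw [map_zero]; exact hΨ) P.hasStrictFDerivAt
    have hPsurj : (((generatorK E x).coprod (ContinuousLinearMap.id ℝ E)).comp P).range = ⊤ := by
      rw [LinearMap.range_eq_top]
      intro v
      obtain ⟨w, κ, h⟩ := hspan (v - j (L v)) (by rw [map_sub, hj, sub_self])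
      refine ⟨(κ, w, L v), ?_⟩
      rw [sub_eq_iff_eq_add] at h
      change generatorK E x κ + (ι w + j (L v)) = v
      refine Eq.trans ?_ h.symm
      abel
    have hmap := hΨP.map_nhds_eq_of_surj hPsurj
    have hPtend : Filter.Tendsto P (𝓝 0) (𝓝 0) := by simpa using P.continuous.tendsto 0
    have hgood : ∀ᶠ p : LieK × EuclideanSpace ℝ (Fin d) × (LieK →L[ℝ] ℝ) in 𝓝 0,
        p.2.1 ∈ N ∧ f (R (P p).2) = f y₀ + L (P p).2 ∧
          expK (P p).1 • φ.symm (R (P p).2) ∈ φ.source := by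
      refine Filter.Eventually.and ?_ (Filter.Eventually.and ?_ ?_)
      · exact (continuous_snd.fst.tendsto' _ _ rfl).eventually hN
      · exact ((continuous_snd.tendsto' (0 : LieK × E) 0 rfl).comp hPtend).eventually hRL
      · refine hPtend.eventually (hΨc.preimage_mem_nhds ?_)
        have : expK (0 : LieK × E).1 • φ.symm (R (0 : LieK × E).2) = x := by
          simp [expK_zero, hR0, hsymm0]
        rw [this]
        exact extChartAt_source_mem_nhds x
    have himg := hmap ▸ Filter.image_mem_map hgood
    have hval : φ (expK (P 0).1 • φ.symm (R (P 0).2)) = y₀ := by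
      rw [map_zero, Prod.fst_zero, Prod.snd_zero, expK_zero, one_smul, hR0, hsymm0]
    rw [hval] at himg
    filter_upwards [(continuousAt_extChartAt (I := 𝓘(ℝ, E)) x).preimage_mem_nhds himg,
      extChartAt_source_mem_nhds (I := 𝓘(ℝ, E)) x] with y hy hys hyJ
    obtain ⟨⟨κ, w, n⟩, ⟨hw, hFR, hsrc⟩, hpy⟩ := hy
    have hyeq : expK κ • φ.symm (R (ι w + j n)) = y := φ.injOn hsrc hys hpy
    -- In the straightened coordinates J^𝒦 differs from its value at x by exactly n.
    have hn : n = 0 := by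
      have h1 : momentumK J y = f (R (ι w + j n)) := by
        rw [← hyeq, momentumK_smul hJ.equivariant (expK_mem κ)]
        rfl
      have h2 : f (R (ι w + j n)) = f y₀ + L (ι w + j n) := hFR
      rw [map_add, hι, hj, zero_add, hf0, ← h1, hyJ] at h2
      simpa using h2
    refine ⟨expK κ, expK_mem κ, w, hw, ?_⟩
    rw [← hyeq, hn, map_zero, add_zero]

end Slice

/-! ### Stability -/

section Stability

open scoped Pointwise in
/-- Continuous curves in `P` along which `G` is constant stay near the orbit of a strict minimum
of `G` on a slice for a proper action on `P`. -/
lemma exists_trapping {𝒢 M W : Type*} [Group 𝒢] [TopologicalSpace 𝒢] [TopologicalSpace M]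
    [MulAction 𝒢 M] [ProperSMul 𝒢 M] [NormedAddCommGroup W] [NormedSpace ℝ W]
    [FiniteDimensional ℝ W] {K : Subgroup 𝒢} (hK : IsClosed (K : Set 𝒢)) {P : Set M}
    (hP : ∀ k ∈ K, ∀ y ∈ P, k • y ∈ P) {G : M → ℝ} (hG : Continuous G)
    (hGK : ∀ k ∈ K, ∀ y ∈ P, G (k • y) = G y) {σ : W → M}
    (hσ : ∀ᶠ w in 𝓝 0, ContinuousAt σ w) (hσP : ∀ᶠ w in 𝓝 0, σ w ∈ P)
    (hmin : ∀ᶠ w in 𝓝 0, w ≠ 0 → G (σ 0) < G (σ w))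
    (htube : ∀ N ∈ 𝓝 (0 : W), ∀ᶠ y in 𝓝 (σ 0), y ∈ P → ∃ k ∈ K, ∃ w ∈ N, y = k • σ w)
    {U : Set M} (hU : U ∈ 𝓝 (σ 0)) :
    ∃ V ∈ 𝓝 (σ 0), ∃ C ⊆ U, IsCompact C ∧ ∀ (γ : ℝ → M) (a b : ℝ), a < 0 → 0 < b →
      ContinuousOn γ (Ioo a b) → γ 0 ∈ V → (∀ t ∈ Ioo a b, γ t ∈ P) →
      (∀ t ∈ Ioo a b, G (γ t) = G (γ 0)) →
      ∀ t ∈ Ioo a b, ∃ k ∈ K, ∃ u ∈ C, γ t = k • u := by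
  have hσU : ∀ᶠ w in 𝓝 0, σ w ∈ U := hσ.self_of_nhds.preimage_mem_nhds hU
  obtain ⟨r, hr, hball⟩ := (Metric.nhds_basis_closedBall.eventually_iff).1
    (hσ.and (hσP.and (hmin.and hσU)))
  have hσr : ContinuousOn σ (Metric.closedBall 0 r) := fun w hw =>
    (hball hw).1.continuousWithinAt
  set C := σ '' Metric.closedBall 0 r with hC
  have hCc : IsCompact C := (isCompact_closedBall 0 r).image_of_continuousOn hσr
  have hCU : C ⊆ U := by
    rintro _ ⟨w, hw, rfl⟩
    exact (hball hw).2.2.2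
  -- Points of V₀ in P lie in K • C, and σ maps the δ-ball into V₀. The value m bounds G from below
  -- on the shell in between.
  obtain ⟨V₀, hV₀, hV₀o, hV₀σ⟩ := eventually_nhds_iff.1
    (htube _ (Metric.closedBall_mem_nhds (0 : W) hr))
  obtain ⟨δ, hδ, hδV⟩ := Metric.eventually_nhds_iff_ball.1
    (hσ.self_of_nhds.preimage_mem_nhds (hV₀o.mem_nhds hV₀σ))
  obtain ⟨m, hm, hmA⟩ : ∃ m, G (σ 0) < m ∧
      ∀ w ∈ Metric.closedBall (0 : W) r \ Metric.ball 0 δ, m ≤ G (σ w) := by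
    have hA : IsCompact (Metric.closedBall (0 : W) r \ Metric.ball 0 δ) :=
      (isCompact_closedBall 0 r).diff Metric.isOpen_ball
    rcases (Metric.closedBall (0 : W) r \ Metric.ball 0 δ).eq_empty_or_nonempty with he | hne
    · exact ⟨G (σ 0) + 1, by linarith, by simp [he]⟩
    · obtain ⟨w, hw, hwm⟩ := hA.exists_isMinOn hne
        (hG.comp_continuousOn (hσr.mono sdiff_subset))
      refine ⟨G (σ w), (hball hw.1).2.2.1 ?_, fun w' hw' => hwm hw'⟩
      rintro rfl
      exact hw.2 (Metric.mem_ball_self hδ)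
  have hKC : IsClosed ((K : Set 𝒢) • C) := hK.smul_right_of_isCompact hCc
  refine ⟨V₀ ∩ {y | G y < m}, Filter.inter_mem (hV₀o.mem_nhds hV₀σ)
    ((isOpen_lt hG continuous_const).mem_nhds hm), C, hCU, hCc, ?_⟩
  intro γ a b ha hb hγ hγ0 hγP hγG
  have h0 : (0 : ℝ) ∈ Ioo a b := ⟨ha, hb⟩
  set T := Ioo a b ∩ γ ⁻¹' ((K : Set 𝒢) • V₀) with hT
  have hTo : IsOpen T := hγ.isOpen_inter_preimage isOpen_Ioo hV₀o.smul_left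
  have hTC : ∀ t ∈ T, γ t ∈ (K : Set 𝒢) • C := by
    rintro t ⟨ht, k, hk, v, hv, hkv⟩
    have hkv' : k • v = γ t := hkv
    have hvP : v ∈ P := by
      have := hP k⁻¹ (K.inv_mem hk) _ (hγP t ht)
      rwa [← hkv', inv_smul_smul] at this
    obtain ⟨k', hk', w, hw, rfl⟩ := hV₀ v hv hvP
    rw [← hkv', smul_smul]
    exact smul_mem_smul (K.mul_mem hk hk') (mem_image_of_mem σ hw)
  -- T is open and is shown to be closed in the interval: a limit point lies over some k • σ w with
  -- w in the closed r-ball, and G < m excludes the shell, so w is in the δ-ball and σ w in V₀.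
  have hsub : Ioo a b ⊆ T := by
    refine isPreconnected_Ioo.subset_of_closure_inter_subset hTo ⟨0, h0, h0, ?_⟩ ?_
    · exact ⟨1, K.one_mem, γ 0, hγ0.1, one_smul _ _⟩
    · rintro t ⟨htc, ht⟩
      have h1 : γ t ∈ closure (γ '' T) :=
        ((hγ t ht).mono inter_subset_left).mem_closure_image htc
      have h2 : γ t ∈ (K : Set 𝒢) • C :=
        hKC.closure_subset_iff.2 (image_subset_iff.2 hTC) h1
      obtain ⟨k, hk, _, ⟨w, hw, rfl⟩, hkw⟩ := h2
      have hkw' : k • σ w = γ t := hkw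
      have h3 : G (σ w) < m := by
        rw [← hGK k hk _ (hball hw).2.1, hkw', hγG t ht]
        exact hγ0.2
      have hwδ : w ∈ Metric.ball (0 : W) δ := by
        by_contra hwδ
        exact absurd h3 (not_lt.2 (hmA w ⟨hw, hwδ⟩))
      exact ⟨ht, k, hk, σ w, hδV w hwδ, hkw⟩
  intro t ht
  obtain ⟨k, hk, u, hu, hku⟩ := hTC t (hsub ht)
  exact ⟨k, hk, u, hu, hku.symm⟩

variable {E : Type*} [NormedAddCommGroup E] [NormedSpace ℝ E]
  {M : Type*} [TopologicalSpace M] [ChartedSpace E M]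

lemma hasFDerivAt_comp_zero {d : ℕ} {σ : EuclideanSpace ℝ (Fin d) → M} {x : M} (hx : σ 0 = x)
    (hσ : MDifferentiableAt 𝓘(ℝ, EuclideanSpace ℝ (Fin d)) 𝓘(ℝ, E) σ 0) {f : M → ℝ}
    (hf : MDifferentiableAt 𝓘(ℝ, E) 𝓘(ℝ, ℝ) f x)
    (h : ∀ w, mfderiv 𝓘(ℝ, E) 𝓘(ℝ, ℝ) f x (derivAtZero E x σ w) = 0) :
    HasFDerivAt (fun w => f (σ w)) (0 : EuclideanSpace ℝ (Fin d) →L[ℝ] ℝ) 0 := by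
  subst hx
  have h1 := hf.hasMFDerivAt.comp (0 : EuclideanSpace ℝ (Fin d)) hσ.hasMFDerivAt
  let D : E →L[ℝ] ℝ := mfderiv 𝓘(ℝ, E) 𝓘(ℝ, ℝ) f (σ 0)
  have e : D.comp (derivAtZero E (σ 0) σ) = 0 := ContinuousLinearMap.ext h
  have h2 : HasFDerivAt (fun w => f (σ w)) (D.comp (derivAtZero E (σ 0) σ)) 0 := h1.hasFDerivAt
  rwa [e] at h2

variable [MulAction EucG M]

/-- SO(2)_D fixes x, so this one-parameter orbit is constant. -/
lemma generator_diag_eq_zero {x : M} (hx : IsAxisymmetric M x) :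
    generator E (1, (0, 1)) x = 0 := by
  have h : (fun t : ℝ => expG (1, (0, 1)) t • x) = fun _ => x := by
    funext t
    have : expG (1, (0, 1)) t ∈ MulAction.stabilizer EucG x := by
      rw [hx]
      exact ⟨by simp [expG], rfl⟩
    exact this
  have h1 : (mfderiv 𝓘(ℝ, ℝ) 𝓘(ℝ, E) (fun t : ℝ => expG (1, (0, 1)) t • x) 0 : ℝ →L[ℝ] E) = 0 := by
    rw [h]
    exact mfderiv_const
  exact congrArg (fun A : ℝ →L[ℝ] E => A 1) h1

variable [IsManifold 𝓘(ℝ, E) ∞ M] [FiniteDimensional ℝ E] {Ω : BilinField E M}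
  {J : M → (LieG →L[ℝ] ℝ)} {H : M → ℝ}

omit [IsManifold 𝓘(ℝ, E) ∞ M] [FiniteDimensional ℝ E] in
lemma IsReducedSlice.derivMomentumK_derivAtZero {x : M} {d : ℕ}
    {σ : EuclideanSpace ℝ (Fin d) → M} (hσ : IsReducedSlice E J x σ)
    (hsmooth : IsSmoothAction E M) (w : EuclideanSpace ℝ (Fin d)) :
    derivMomentumK E J x (derivAtZero E x σ w) = 0 := by
  refine (hσ.spans (derivAtZero E x σ w)).2 ⟨w, 0, ?_⟩
  have h : (generator E (0, (0 : LieK)) x : E) = 0 :=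
    (generator_inr hsmooth 0 x).trans (map_zero _)
  let v : E := derivAtZero E x σ w
  exact ((congrArg (fun u : E => v + u) h).trans (add_zero v)).symm

/-- An axisymmetric relative equilibrium is a critical point of the reduced Hamiltonian and of the
reduced momentum. -/
lemma IsReducedSlice.hasFDerivAt_zero {x : M} {d : ℕ} {σ : EuclideanSpace ℝ (Fin d) → M}
    (hσ : IsReducedSlice E J x σ) (hΩ : IsSymplecticForm Ω) (hJ : IsEquivariantMomentumMap Ω J)
    (hsmooth : IsSmoothAction E M) (hH : ContMDiff 𝓘(ℝ, E) 𝓘(ℝ, ℝ) ∞ H)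
    (hx : IsAxisymmetric M x) (hrel : IsRelativeEquilibrium (hamVF Ω H) x) :
    HasFDerivAt (fun w => H (σ w)) (0 : EuclideanSpace ℝ (Fin d) →L[ℝ] ℝ) 0 ∧
      HasFDerivAt (fun w => momentumD J (σ w)) (0 : EuclideanSpace ℝ (Fin d) →L[ℝ] ℝ) 0 := by
  obtain ⟨A, hA⟩ := hJ.exists_linear x
  have hσd : MDifferentiableAt 𝓘(ℝ, EuclideanSpace ℝ (Fin d)) 𝓘(ℝ, E) σ 0 :=
    hσ.smooth.mdifferentiableAt (by simp)
  let B : E →L[ℝ] E →L[ℝ] ℝ := Ω x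
  have hdiag : ∀ u : E, A u (1, (0, 1)) = 0 := fun u =>
    (hA (1, (0, 1)) u).symm.trans ((hJ.momentum (1, (0, 1)) x u).symm.trans
      ((congrArg (fun g : E => B g u) (generator_diag_eq_zero (E := E) hx)).trans
        (congrArg (fun f : E →L[ℝ] ℝ => f u) (map_zero B))))
  have hK : ∀ w κ, A (derivAtZero E x σ w) (0, κ) = 0 := fun w κ =>
    (hA (0, κ) _).symm.trans ((hJ.derivMomentumK_apply x _ κ).symm.trans
      (congrArg (fun n : LieK →L[ℝ] ℝ => n κ) (hσ.derivMomentumK_derivAtZero hsmooth w)))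
  -- 𝔤 is spanned by the diagonal direction (1, 0, 1) and 𝔨, and DJ(x) has no diagonal component.
  -- Hence all of DJ(x) vanishes on slice directions, and so does DH(x) = DJ_ξ(x), because f_H(x) =
  -- ξ x.
  have hsplit : ∀ (u : E), (∀ κ, A u (0, κ) = 0) → ∀ ξ, A u ξ = 0 := fun u hu ξ => by
    have e : ξ = ξ.1 • ((1, (0, 1)) : LieG) + (0, (ξ.2.1, ξ.2.2 - ξ.1)) := by
      ext <;> simp
    rw [e, map_add, map_smul, hdiag, hu, smul_zero, add_zero]
  have hAσ : ∀ w ξ, A (derivAtZero E x σ w) ξ = 0 := fun w => hsplit _ (hK w)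
  obtain ⟨ξ, hξ⟩ := hrel
  have hgen : (hamVF Ω H x : E) = generator E ξ x :=
    (congrArg (fun y => (hamVF Ω H y : E)) (expG_zero_smul ξ x)).symm.trans
      (mfderiv_curve_apply_one (hξ 0)).symm
  refine ⟨hasFDerivAt_comp_zero hσ.base hσd (hH.mdifferentiable (by simp) x) fun w => ?_,
    hasFDerivAt_comp_zero hσ.base hσd
      ((hJ.contMDiff_apply (1, (0, 1))).mdifferentiable (by simp) x) fun w => ?_⟩
  · refine (hamVF_spec hΩ H x _).symm.trans ?_
    refine Eq.trans (congrArg (fun u : E => (Ω x : E →L[ℝ] E →L[ℝ] ℝ) u (derivAtZero E x σ w))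
      hgen) ?_
    exact (hJ.momentum ξ x _).trans ((hA ξ _).trans (hAσ w ξ))
  · exact (hA _ _).trans (hAσ w _)

/-- Integral curves through points of a compact set, and through its translates, exist for a
uniform time. -/
lemma exists_uniform_isMIntegralCurveOn (hΩ : IsSymplecticForm Ω)
    (hsmooth : IsSmoothAction E M) (hinvΩ : IsInvariantForm Ω)
    (hH : ContMDiff 𝓘(ℝ, E) 𝓘(ℝ, ℝ) ∞ H) (hinvH : ∀ (g : EucG) (x : M), H (g • x) = H x)
    {C : Set M} (hC : IsCompact C) :
    ∃ ε > 0, ∀ (g : EucG), ∀ u ∈ C, ∃ γ : ℝ → M, γ 0 = g • u ∧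
      IsMIntegralCurveOn (I := 𝓘(ℝ, E)) γ (hamVF Ω H) (Ioo (-ε) ε) := by
  have : IsManifold 𝓘(ℝ, E) 1 M := .of_le (n := ∞) (by norm_cast)
  have : CompleteSpace E := FiniteDimensional.complete ℝ E
  have hv := contMDiff_hamVF hΩ hH
  obtain ⟨ε, hε, h⟩ : ∃ ε > 0, ∀ u ∈ C, ∃ γ : ℝ → M, γ 0 = u ∧
      IsMIntegralCurveOn (I := 𝓘(ℝ, E)) γ (hamVF Ω H) (Ioo (-ε) ε) := by
    refine hC.induction_on (p := fun S => ∃ ε > 0, ∀ u ∈ S, ∃ γ : ℝ → M, γ 0 = u ∧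
      IsMIntegralCurveOn (I := 𝓘(ℝ, E)) γ (hamVF Ω H) (Ioo (-ε) ε)) ⟨1, one_pos, by simp⟩
      (fun S T hST ⟨ε, hε, h⟩ => ⟨ε, hε, fun u hu => h u (hST hu)⟩) ?_ ?_
    · rintro S T ⟨ε, hε, h⟩ ⟨ε', hε', h'⟩
      refine ⟨min ε ε', lt_min hε hε', ?_⟩
      rintro u (hu | hu)
      · obtain ⟨γ, h0, hγ⟩ := h u hu
        exact ⟨γ, h0, hγ.mono (Ioo_subset_Ioo (neg_le_neg (min_le_left _ _)) (min_le_left _ _))⟩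
      · obtain ⟨γ, h0, hγ⟩ := h' u hu
        exact ⟨γ, h0, hγ.mono (Ioo_subset_Ioo (neg_le_neg (min_le_right _ _)) (min_le_right _ _))⟩
    · intro x _
      obtain ⟨ε, hε, h⟩ := exists_eventually_isMIntegralCurveOn (hv x)
      exact ⟨_, mem_nhdsWithin_of_mem_nhds h, ε, hε, fun u hu => hu⟩
  refine ⟨ε, hε, fun g u hu => ?_⟩
  obtain ⟨γ, h0, hγ⟩ := h u hu
  exact ⟨fun t => g • γ t, congrArg (g • ·) h0, isMIntegralCurveOn_smul hΩ hsmooth hinvΩ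
    (hH.mdifferentiable (by simp)) hinvH hγ g⟩

/-- Energy-momentum criterion: a conserved function with a strict minimum on a reduced slice
yields stability. -/
lemma isStableUnder_of_strict_min [T2Space M] [ProperSMul EucG M]
    (hΩ : IsSymplecticForm Ω) (hH : ContMDiff 𝓘(ℝ, E) 𝓘(ℝ, ℝ) ∞ H)
    (hsmooth : IsSmoothAction E M) (hinvΩ : IsInvariantForm Ω)
    (hinvH : ∀ (g : EucG) (x : M), H (g • x) = H x)
    (hJ : IsEquivariantMomentumMap Ω J) {x : M} {d : ℕ} {σ : EuclideanSpace ℝ (Fin d) → M}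
    (hσ : IsReducedSlice E J x σ)
    (htube : ∀ N ∈ 𝓝 (0 : EuclideanSpace ℝ (Fin d)), ∀ᶠ y in 𝓝 x,
      momentumK J y = momentumK J x → ∃ k ∈ subgroupK, ∃ w ∈ N, y = k • σ w)
    {G : M → ℝ} (hG : ContMDiff 𝓘(ℝ, E) 𝓘(ℝ, ℝ) ∞ G)
    (hGK : ∀ k ∈ subgroupK, ∀ y, momentumK J y = momentumK J x → G (k • y) = G y)
    (hGH : ∀ y, mfderiv 𝓘(ℝ, E) 𝓘(ℝ, ℝ) G y (hamVF Ω H y) = 0)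
    (hmin : ∀ᶠ w in 𝓝 0, w ≠ 0 → G (σ 0) < G (σ w)) :
    IsStableUnder (subgroupK : Set EucG) (hamVF Ω H) {y | momentumK J y = momentumK J x} x := by
  intro U hU
  have : IsManifold 𝓘(ℝ, E) 1 M := .of_le (n := ∞) (by norm_cast)
  have hv := contMDiff_hamVF hΩ hH
  -- Smoothness at 0 is lowered to order one, which spreads to a neighbourhood and gives continuity
  -- there.
  have hcont : ∀ᶠ w in 𝓝 0, ContinuousAt σ w :=
    ((contMDiffAt_iff_contMDiffAt_nhds (n := 1) (by simp)).1 (hσ.smooth.of_le (by norm_cast))).mono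
      fun w hw => hw.continuousAt
  obtain ⟨V, hV, C, hCU, hC, htrap⟩ := exists_trapping (U := U) isClosed_subgroupK
    (P := {y | momentumK J y = momentumK J x})
    (fun k hk y hy => (momentumK_smul hJ.equivariant hk y).trans hy) hG.continuous
    hGK hcont hσ.level hmin (by rw [hσ.base]; exact htube) (by rwa [hσ.base])
  rw [hσ.base] at hV
  refine ⟨V, hV, ?_⟩
  rintro x₀ ⟨hx₀V, hx₀P⟩
  have hstay : ∀ (γ : ℝ → M) (a b : ℝ), a < 0 → 0 < b → γ 0 = x₀ →
      IsMIntegralCurveOn (I := 𝓘(ℝ, E)) γ (hamVF Ω H) (Ioo a b) →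
      ∀ t ∈ Ioo a b, ∃ k ∈ subgroupK, ∃ u ∈ C, γ t = k • u := by
    intro γ a b ha hb h0 hγ
    have h0ab : (0 : ℝ) ∈ Ioo a b := ⟨ha, hb⟩
    refine htrap γ a b ha hb hγ.continuousOn (by rwa [h0]) (fun t ht => ?_) fun t ht => ?_
    · rw [← h0] at hx₀P
      refine Eq.trans (ContinuousLinearMap.ext fun κ => ?_) hx₀P
      exact eq_of_isMIntegralCurveOn ((hJ.contMDiff_apply (0, κ)).mdifferentiable (by simp))
        (mfderiv_momentum_hamVF hΩ (hH.mdifferentiable (by simp)) hinvH hJ (0, κ)) hγ ht h0ab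
    · exact eq_of_isMIntegralCurveOn (hG.mdifferentiable (by simp)) hGH hγ ht h0ab
  refine ⟨?_, fun γ a b ha hb h0 hγ t ht => ?_⟩
  · obtain ⟨ε, hε, hunif⟩ := exists_uniform_isMIntegralCurveOn hΩ hsmooth hinvΩ hH hinvH hC
    refine exists_isMIntegralCurve_of_mapsTo (A := {y | ∃ k ∈ subgroupK, ∃ u ∈ C, y = k • u})
      hv hε ?_ ?_ ?_
    · rintro _ ⟨k, -, u, hu, rfl⟩
      exact hunif k u hu
    -- Trapping applied to a constant curve shows that x₀ itself lies in 𝒦C.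
    · exact htrap (fun _ => x₀) (-1) 1 (by norm_num) one_pos continuousOn_const hx₀V
        (fun _ _ => hx₀P) (fun _ _ => rfl) 0 (by norm_num)
    · intro γ a h0 hγ t ht
      have ha : 0 < a := by linarith [ht.1, ht.2]
      exact hstay γ (-a) a (by linarith) ha h0 hγ t ht
  · obtain ⟨k, hk, u, hu, h⟩ := hstay γ a b ha hb h0 hγ t ht
    exact ⟨k, hk, u, hCU hu, h⟩

end Stability
end AxiRelEq

/-! ### Formal stability implies 𝒦-stability -/

theorem mainTheorem5
    {E : Type*} [NormedAddCommGroup E] [NormedSpace ℝ E] [FiniteDimensional ℝ E]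
    {M : Type*} [TopologicalSpace M] [T2Space M] [SecondCountableTopology M] [ConnectedSpace M]
    [ChartedSpace E M] [IsManifold 𝓘(ℝ, E) ∞ M]
    (Ω : BilinField E M) (hΩ : IsSymplecticForm Ω)
    (H : M → ℝ) (hH : ContMDiff 𝓘(ℝ, E) 𝓘(ℝ, ℝ) ∞ H)
    [MulAction EucG M] [FaithfulSMul EucG M] [ProperSMul EucG M]
    (hsmooth : IsSmoothAction E M) (hinvΩ : IsInvariantForm Ω)
    (hinvH : ∀ (g : EucG) (x : M), H (g • x) = H x)
    (J : M → (LieG →L[ℝ] ℝ)) (hJ : IsEquivariantMomentumMap Ω J)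
    (xe : M) (hrel : IsRelativeEquilibrium (hamVF Ω H) xe) (haxi : IsAxisymmetric M xe)
    (hformal : IsFormallyStable E H J xe) :
    IsStableUnder (subgroupK : Set EucG) (hamVF Ω H)
      {x | momentumK J x = momentumK J xe} xe := by
  obtain ⟨d, σ, hσ, htube⟩ := exists_isReducedSlice hJ hΩ hsmooth
    (x := xe) fun κ => generator_injective_of_isAxisymmetric hsmooth haxi
  obtain ⟨lam, hlam⟩ := hformal
  obtain ⟨hdH, hdJ⟩ := hσ.hasFDerivAt_zero hΩ hJ hsmooth hH haxi hrel
  let G : M → ℝ := fun y => H y + lam * momentumD J y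
  have hJD : ContMDiff 𝓘(ℝ, E) 𝓘(ℝ, ℝ) ∞ (momentumD J) := hJ.contMDiff_apply (1, (0, 1))
  have hG : ContMDiff 𝓘(ℝ, E) 𝓘(ℝ, ℝ) ∞ G := hH.add (contMDiff_const.mul hJD)
  have hGK : ∀ k ∈ subgroupK, ∀ y, momentumK J y = momentumK J xe → G (k • y) = G y :=
    fun k hk y hy => by simp only [G, hinvH, momentumD_smul hJ.equivariant haxi hy hk]
  have hGH : ∀ y, mfderiv 𝓘(ℝ, E) 𝓘(ℝ, ℝ) G y (hamVF Ω H y) = 0 := fun y => by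
    have hH1 := hH.mdifferentiable (by simp)
    have hD := mfderiv_momentum_hamVF hΩ hH1 hinvH hJ (1, (0, 1)) y
    let A : E →L[ℝ] ℝ := mfderiv 𝓘(ℝ, E) 𝓘(ℝ, ℝ) H y
    let B : E →L[ℝ] ℝ := mfderiv 𝓘(ℝ, E) 𝓘(ℝ, ℝ) (momentumD J) y
    let v : E := hamVF Ω H y
    have h1 : HasMFDerivAt 𝓘(ℝ, E) 𝓘(ℝ, ℝ) G y (A + lam • B) :=
      (hH1 y).hasMFDerivAt.add ((hJD.mdifferentiable (by simp) y).hasMFDerivAt.const_smul lam)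
    have hA : A v = 0 := mfderiv_hamVF_self hΩ H y
    have hB : B v = 0 := hD
    have h2 : (A + lam • B) v = 0 := by simp [hA, hB]
    exact (congrArg (fun D : E →L[ℝ] ℝ => D v) h1.mfderiv).trans h2
  have hGσ : ContDiffAt ℝ 2 (fun w => G (σ w)) 0 :=
    ((hG.contMDiffAt.comp 0 hσ.smooth).contDiffAt).of_le (by norm_cast)
  have hG0 : HasFDerivAt (fun w => G (σ w)) (0 : EuclideanSpace ℝ (Fin d) →L[ℝ] ℝ) 0 := by
    have h : HasFDerivAt (fun w => H (σ w) + lam * momentumD J (σ w))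
        (0 + lam • (0 : EuclideanSpace ℝ (Fin d) →L[ℝ] ℝ)) 0 := hdH.add (hdJ.const_mul lam)
    rwa [smul_zero, add_zero] at h
  rcases hlam d σ hσ with hpos | hneg
  · exact isStableUnder_of_strict_min hΩ hH hsmooth hinvΩ hinvH hJ hσ htube hG hGK hGH
      (eventually_lt_of_hessian_pos hGσ hG0.fderiv hpos)
  -- For a negative definite Hessian the conserved function −G has the strict minimum.
  · refine isStableUnder_of_strict_min (G := fun y => -G y) hΩ hH hsmooth hinvΩ hinvH hJ hσ htube
      hG.neg (fun k hk y hy => congrArg Neg.neg (hGK k hk y hy)) (fun y => ?_)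
      (eventually_lt_of_hessian_pos hGσ.neg ?_ fun w hw => ?_)
    · let D : E →L[ℝ] ℝ := mfderiv 𝓘(ℝ, E) 𝓘(ℝ, ℝ) G y
      let v : E := hamVF Ω H y
      have h1 : HasMFDerivAt 𝓘(ℝ, E) 𝓘(ℝ, ℝ) (fun y => -G y) y (-D) :=
        (hG.mdifferentiable (by simp) y).hasMFDerivAt.neg
      have hD : D v = 0 := hGH y
      have h2 : (-D) v = 0 := by simp [hD]
      exact (congrArg (fun D : E →L[ℝ] ℝ => D v) h1.mfderiv).trans h2
    · exact hG0.neg.fderiv.trans neg_zero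
    · have h1 : fderiv ℝ (fun w => -G (σ w)) = fun w => -fderiv ℝ (fun w => G (σ w)) w := by
        funext w
        exact fderiv_fun_neg
      have h2 : fderiv ℝ (fderiv ℝ fun w => -G (σ w)) 0
          = -fderiv ℝ (fderiv ℝ fun w => G (σ w)) 0 := by
        rw [h1]
        exact fderiv_fun_neg
      change 0 < fderiv ℝ (fderiv ℝ fun w => -G (σ w)) 0 w w
      rw [h2]
      exact neg_pos.2 (hneg w hw)
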